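/- Let $R$ be a commutative domain of Krull dimension $1$ that is $h$-local, that is, every non-zero element of $R$ lies in only finitely many maximal ideals and every non-zero prime ideal of $R$ lies in exactly one maximal ideal. Let $X$ be a finitely generated torsion-free $R$-module such that every direct summand of $R^{(\omega)}\oplus X$ is a direct sum of finitely generated $R$-modules. Then, for every maximal ideal $\mathfrak m$ of $R$, the ring $\operatorname{End}_{R_{\mathfrak m}}(X_{\mathfrak m})$ is semiperfect (it is semisimple artinian modulo its Jacobson radical, and idempotents lift modulo the Jacobson radical). Moreover, the following conditions also hold, where $\operatorname{Add}(M)$ denotes the class of modules isomorphic to direct summands of (arbitrary) direct sums of copies of $M$: (a) every module in $\operatorname{Add}(R_{\mathfrak m}\oplus X_{\mathfrak m})$ is a direct sum of finitely generated $R_{\mathfrak m}$-modules; (b) every direct summand of $R_{\mathfrak m}^{(\omega)}\oplus X_{\mathfrak m}$ is a direct sum of finitely generated $R_{\mathfrak m}$-modules; (c) every finitely generated indecomposable module in $\operatorname{Add}(R_{\mathfrak m}\oplus X_{\mathfrak m})$ has a local endomorphism ring. -/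

import Mathlib

universe u v w

/-- A commutative domain is `h`-local if every non-zero element lies in only finitely many maximal
ideals (finite character) and every non-zero prime ideal lies in exactly one maximal ideal. -/
structure IsHLocalDomain (R : Type*) [CommRing R] [IsDomain R] : Prop where
  finite_character : ∀ r : R, r ≠ 0 → {m : Ideal R | m.IsMaximal ∧ r ∈ m}.Finite
  existsUnique_maximal : ∀ p : Ideal R, p.IsPrime → p ≠ ⊥ → ∃! m : Ideal R, m.IsMaximal ∧ p ≤ m

/-- A ring `S`, not necessarily commutative, is semiperfect if `S / J(S)` is semisimple artinian and
every idempotent of `S / J(S)` lifts to an idempotent of `S`. -/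
structure IsSemiperfectRing (S : Type*) [Ring S] : Prop where
  isSemisimpleRing : IsSemisimpleRing (S ⧸ Ring.jacobson S)
  exists_lift : ∀ e : S ⧸ Ring.jacobson S, IsIdempotentElem e →
    ∃ f : S, IsIdempotentElem f ∧ Ideal.Quotient.mk (Ring.jacobson S) f = e

/-- `N` is a direct sum of finitely generated modules: it is the internal direct sum of a family of
finitely generated submodules. Since only the non-zero members of the family matter, and these are
pairwise distinct and independent, index types in the universe of `N` suffice. -/
def IsDirectSumOfFG (R : Type u) [Ring R] (N : Type w) [AddCommGroup N] [Module R N] : Prop :=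
  ∃ (ι : Type w) (_ : DecidableEq ι) (A : ι → Submodule R N), DirectSum.IsInternal A ∧ ∀ i, (A i).FG

/-- Every direct summand of `M` is a direct sum of finitely generated modules. -/
def SummandsAreDirectSumsOfFG (R : Type*) [Ring R] (M : Type*) [AddCommGroup M] [Module R M] :
    Prop :=
  ∀ N N' : Submodule R M, IsCompl N N' → IsDirectSumOfFG R N

/-- `N` belongs to `Add(M)`: it is isomorphic to a direct summand of a direct sum of copies of `M`.
A summand `N` of `M^(I)` is already a summand of `M^(I')` for some `I' ⊆ I` of cardinality at most
`max(ℵ₀, |N|)`, so index types in the universe of `N` suffice. -/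
def MemAdd (R : Type u) [Ring R] (M : Type v) [AddCommGroup M] [Module R M]
    (N : Type w) [AddCommGroup N] [Module R N] : Prop :=
  ∃ (I : Type w) (i : N →ₗ[R] (I →₀ M)) (p : (I →₀ M) →ₗ[R] N), p ∘ₗ i = LinearMap.id

/-- `N` is indecomposable: it is non-zero and is not a direct sum of two non-zero submodules. -/
def IsIndecomposableModule (R : Type*) [Ring R] (N : Type*) [AddCommGroup N] [Module R N] : Prop :=
  Nontrivial N ∧ ∀ A B : Submodule R N, IsCompl A B → A = ⊥ ∨ B = ⊥

/-!
Everything follows once the endomorphism ring of `X_m` is shown to be an exchange ring in the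
element-wise sense of `IsExchangeRing`.

*Consequences of the exchange property.* Idempotents of an exchange ring lift modulo every ideal,
and over a local ring the endomorphism ring of a finitely generated module is artinian modulo its
radical, so exchange gives semiperfect. The property passes to finite direct sums, so
`Z = R_m ⊕ X_m` has it, and to retracts, so every finitely generated module in `Add(Z)` has it; an
indecomposable module with this property has local endomorphism ring. For arbitrary modules in
`Add(Z)`, exchange endomorphism rings let one enlarge any finitely generated submodule of a summand
of `Z^(I)` to a finitely generated summand; this settles countably generated summands, and
Kaplansky's dévissage reduces the general case to them (`MemAdd.isDirectSumOfFG`).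

*Exploiting the hypothesis on `X`.* If `h` is an endomorphism of `X` such that `h - h²` factors
through a free module, then `h` is the corner of an idempotent endomorphism of `X ⊕ R^(ω)`,
constructed explicitly in `exists_idempotent_corner_of_factor`. By hypothesis the range of this
idempotent is a direct sum of finitely generated modules, and keeping only finitely many of them
makes `h` the corner of an idempotent of some `X ⊕ R^n`
(`SummandsAreDirectSumsOfFG.exists_idempotent_corner`).

*Exchange for `X_m`.* Write `X_m = Y ⊕ R_m^n` with `Y` having no non-zero free direct summand, and
let `φ` be an endomorphism of `Y`. Choose a non-zero `r` in `m` such that multiplication by `r` on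
`X` factors through a free module. By Cayley–Hamilton, a suitable multiple of `φ` is idempotent
modulo `r` (`exists_exchange_mod`). As `R / r` is a finite product of local rings, this multiple,
extended by zero to `X_m`, is congruent modulo `r` to some endomorphism `h` of `X` that is
idempotent modulo `r` (`exists_end_congr_localization`). So `h - h²` factors through a free module,
and `h` is a corner of an idempotent of some `X ⊕ R^l`; after localization, Schur complements
remove the free part at the cost of an error in `m Y` (`exists_idempotent_congr_corner`). The
result is an idempotent of `Y` congruent modulo `m` to the chosen multiple of `φ`, and by Nakayama's
lemma that is enough for the exchange condition at `φ`.
-/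

/-! ### Exchange rings -/

/-- An exchange ring, in Nicholson's left-handed form: for every `s` there is an idempotent `e`
with `e ∈ T s` and `1 - e ∈ T (1 - s)`. -/
def IsExchangeRing (T : Type*) [Ring T] : Prop :=
  ∀ s : T, ∃ e t t' : T, IsIdempotentElem e ∧ e = t * s ∧ 1 - e = t' * (1 - s)

section Ring

variable {T : Type*} [Ring T]

/-- The element `s` satisfies the exchange condition as soon as some combination
`e a s + (1 - e) b (1 - s)`, with `e` idempotent, is a unit `u`: the required idempotent is
`u⁻¹ e a s`. -/
theorem exists_idempotent_of_isUnit {s e a b : T} (he : IsIdempotentElem e)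
    (hu : IsUnit (e * a * s + (1 - e) * b * (1 - s))) :
    ∃ e t t' : T, IsIdempotentElem e ∧ e = t * s ∧ 1 - e = t' * (1 - s) := by
  obtain ⟨u, hu⟩ := hu
  have he' : e * (1 - e) = 0 := by rw [mul_sub, mul_one, he.eq, sub_self]
  have h1 : e * u = e * a * s := by
    rw [hu, mul_add, ← mul_assoc, ← mul_assoc, he.eq, ← mul_assoc, ← mul_assoc, he']; simp
  refine ⟨↑u⁻¹ * (e * a * s), ↑u⁻¹ * (e * a), ↑u⁻¹ * ((1 - e) * b), ?_, by simp only [mul_assoc],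
    ?_⟩
  · have h2 : e * a * s * ↑u⁻¹ = e := by rw [← h1, Units.mul_inv_cancel_right]
    have h3 : e * (e * a * s) = e * a * s := by rw [← mul_assoc, ← mul_assoc, he.eq]
    change ↑u⁻¹ * (e * a * s) * (↑u⁻¹ * (e * a * s)) = _
    rw [mul_assoc, ← mul_assoc (e * a * s), h2, h3]
  · have h4 : (1 - e) * b * (1 - s) = u - e * a * s := by rw [hu]; abel
    rw [mul_assoc ↑u⁻¹ ((1 - e) * b), h4, mul_sub, Units.inv_mul]

/-- In an exchange ring idempotents lift modulo every two-sided ideal. -/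
theorem IsExchangeRing.exists_lift (hT : IsExchangeRing T) (I : Ideal T) [I.IsTwoSided]
    (e : T ⧸ I) (he : IsIdempotentElem e) :
    ∃ f : T, IsIdempotentElem f ∧ Ideal.Quotient.mk I f = e := by
  obtain ⟨s, rfl⟩ := Ideal.Quotient.mk_surjective e
  obtain ⟨e, t, t', he', h1, h2⟩ := hT s
  refine ⟨e, he', ?_⟩
  have hs : s - s * s ∈ I := by
    rw [← Ideal.Quotient.eq, map_mul]; exact he.eq.symm
  rw [Ideal.Quotient.eq]
  have : e - s = (t - t') * (s - s * s) := by
    have h3 : e * (1 - s) = t * (s - s * s) := by rw [h1]; noncomm_ring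
    have h4 : (1 - e) * s = t' * (s - s * s) := by rw [h2]; noncomm_ring
    rw [sub_mul, ← h3, ← h4]; noncomm_ring
  rw [this]
  exact I.mul_mem_left _ hs

/-- Two complementary corners satisfying the exchange condition force it for the whole ring. With
respect to the Peirce decomposition given by `f` and `g = 1 - f` one first makes an exchange for
the `f`-corner of `s`, then one for the `g`-corner of `s (g - γ)`, a Schur complement; the resulting
combination is the product of a lower and an upper unitriangular matrix. -/
theorem exists_idempotent_of_corners {f g s e₁ t₁ t₁' γ e₂ t₂ t₂' : T}
    (hf : f * f = f) (hfg : f + g = 1)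
    (he₁ : e₁ * e₁ = e₁) (h₁ : t₁ * s * f = e₁) (h₁' : t₁' * (1 - s) * f = f - e₁)
    (ht₁ : e₁ * t₁ = t₁) (ht₁' : (f - e₁) * t₁' = t₁') (hfe₁ : f * e₁ = e₁) (hef₁ : e₁ * f = e₁)
    (hγ : γ = t₁ * s * g + t₁' * (1 - s) * g)
    (he₂ : e₂ * e₂ = e₂) (h₂ : t₂ * s * (g - γ) = e₂) (h₂' : t₂' * (1 - s) * (g - γ) = g - e₂)
    (ht₂ : e₂ * t₂ = t₂) (ht₂' : (g - e₂) * t₂' = t₂') (hge₂ : g * e₂ = e₂) (heg₂ : e₂ * g = e₂) :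
    ∃ e t t' : T, IsIdempotentElem e ∧ e = t * s ∧ 1 - e = t' * (1 - s) := by
  have hg : g = 1 - f := by rw [← hfg]; abel
  have hfg0 : f * g = 0 := by rw [hg, mul_sub, mul_one, hf, sub_self]
  have hgf0 : g * f = 0 := by rw [hg, sub_mul, one_mul, hf, sub_self]
  have he12 : e₁ * e₂ = 0 := by rw [← hef₁, ← hge₂, mul_assoc, ← mul_assoc f, hfg0]; simp
  have he21 : e₂ * e₁ = 0 := by rw [← heg₂, ← hfe₁, mul_assoc, ← mul_assoc g, hgf0]; simp
  have hft₁ : f * t₁ = t₁ := by rw [← ht₁, ← mul_assoc, hfe₁]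
  have hft₁' : f * t₁' = t₁' := by
    rw [← ht₁', ← mul_assoc, mul_sub, hf, hfe₁]
  have hfγ : f * γ = γ := by rw [hγ, mul_add]; simp only [← mul_assoc, hft₁, hft₁']
  have het' : e₁ * t₁' = 0 := by
    rw [← ht₁', ← mul_assoc, mul_sub, hef₁, he₁, sub_self, zero_mul]
  have he₁γ : t₁ * s * g = e₁ * γ := by
    rw [hγ, mul_add]; simp only [← mul_assoc, ht₁, het']; simp
  have he₁γ' : t₁' * (1 - s) * g = f * γ - e₁ * γ := by rw [hfγ, ← he₁γ, hγ]; abel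
  have hγf : γ * f = 0 := by
    rw [hγ, add_mul, mul_assoc _ g f, mul_assoc _ g f, hgf0]; simp
  set ν := t₂ * s * (f - e₁) + t₂' * (1 - s) * e₁ with hν
  have hgt₂ : e₁ * t₂ = 0 := by rw [← ht₂, ← mul_assoc, he12, zero_mul]
  have hfe₂ : f * e₂ = 0 := by rw [← hge₂, ← mul_assoc, hfg0, zero_mul]
  have hft₂ : f * t₂ = 0 := by rw [← ht₂, ← mul_assoc, hfe₂, zero_mul]
  have hft₂' : f * t₂' = 0 := by rw [← ht₂', ← mul_assoc, mul_sub, hfg0, hfe₂]; simp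
  have hνf : ν * f = ν := by
    rw [hν, add_mul, mul_assoc _ _ f, mul_assoc _ _ f, sub_mul, hf, hef₁]
  have hfν : f * ν = 0 := by
    rw [hν, mul_add]; simp only [← mul_assoc, hft₂, hft₂']; simp
  have hνν : ν * ν = 0 := by rw [← mul_zero ν, ← hfν, ← mul_assoc, hνf]
  have hγγ : γ * γ = 0 := by
    calc γ * γ = γ * f * γ := by rw [mul_assoc, hfγ]
      _ = 0 := by rw [hγf, zero_mul]
  set a := t₁ + t₂ * (1 - s * t₁) with ha
  set b := t₁' + t₂' * (1 - (1 - s) * t₁') with hb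
  have hea : (e₁ + e₂) * a = a := by
    have : e₂ * t₁ = 0 := by rw [← ht₁, ← mul_assoc, he21, zero_mul]
    rw [ha, add_mul, mul_add, mul_add, ← mul_assoc, ← mul_assoc, ht₁, hgt₂, this, ht₂]; simp
  have heb : (1 - (e₁ + e₂)) * b = b := by
    have h1 : e₂ * t₁' = 0 := by rw [← hft₁', ← heg₂, mul_assoc, ← mul_assoc g, hgf0]; simp
    have h2 : e₁ * t₂' = 0 := by rw [← hef₁, mul_assoc, hft₂', mul_zero]
    have h3 : e₂ * t₂' = 0 := by
      rw [← ht₂', ← mul_assoc, mul_sub, heg₂, he₂, sub_self, zero_mul]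
    rw [hb, sub_mul, one_mul, add_mul, mul_add, mul_add, ← mul_assoc, ← mul_assoc, h1, h2, h3, het']
    simp
  have key : a * s + b * (1 - s) = (1 + ν) * (1 + γ) := by
    have e1 : (a * s + b * (1 - s)) * f = f + ν := by
      have : (a * s + b * (1 - s)) * f = t₁ * s * f + t₁' * (1 - s) * f +
        (t₂ * s * f - t₂ * s * (t₁ * s * f) + (t₂' * (1 - s) * f
          - t₂' * (1 - s) * (t₁' * (1 - s) * f))) := by
        rw [ha, hb]; noncomm_ring
      rw [this, h₁, h₁', hν]; noncomm_ring
    have e2 : (a * s + b * (1 - s)) * g = γ + g + ν * γ := by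
      have h5 : (a * s + b * (1 - s)) * g = t₁ * s * g + t₁' * (1 - s) * g +
        (t₂ * s * g - t₂ * s * (t₁ * s * g) + (t₂' * (1 - s) * g
          - t₂' * (1 - s) * (t₁' * (1 - s) * g))) := by
        rw [ha, hb]; noncomm_ring
      have h6 : t₂ * s * g = e₂ + t₂ * s * (f * γ) := by rw [hfγ, ← h₂]; noncomm_ring
      have h7 : t₂' * (1 - s) * g = (g - e₂) + t₂' * (1 - s) * (f * γ) := by
        rw [hfγ, ← h₂']; noncomm_ring
      rw [h5, ← hγ, h6, h7, he₁γ, he₁γ', hν]; noncomm_ring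
    calc a * s + b * (1 - s) = (a * s + b * (1 - s)) * (f + g) := by rw [hfg, mul_one]
      _ = f + ν + (γ + g + ν * γ) := by rw [mul_add, e1, e2]
      _ = (f + g) + ν + γ + ν * γ := by abel
      _ = (1 + ν) * (1 + γ) := by rw [hfg]; noncomm_ring
  have unip : ∀ n : T, n * n = 0 → IsUnit (1 + n) := fun n hn =>
    IsNilpotent.isUnit_one_add ⟨2, by rw [pow_two, hn]⟩
  refine exists_idempotent_of_isUnit (e := e₁ + e₂) (a := a) (b := b) ?_ ?_
  · change (e₁ + e₂) * (e₁ + e₂) = _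
    rw [add_mul, mul_add, mul_add, he₁, he₂, he12, he21]; simp
  · rw [hea, heb, key]
    exact (unip ν hνν).mul (unip γ hγγ)

end Ring

section Module

variable {R : Type*} [Ring R] {A B Q : Type*} [AddCommGroup A] [Module R A] [AddCommGroup B]
  [Module R B] [AddCommGroup Q] [Module R Q]

/-- Retracts of modules with exchange endomorphism ring have exchange endomorphism ring: an
endomorphism `s` of the retract is extended by the identity on the complement. -/
theorem IsExchangeRing.of_retract (hQ : IsExchangeRing (Module.End R Q)) (i : A →ₗ[R] Q)
    (p : Q →ₗ[R] A) (h : p ∘ₗ i = LinearMap.id) : IsExchangeRing (Module.End R A) := by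
  intro s
  have hpi : ∀ x, p (i x) = x := fun x => LinearMap.congr_fun h x
  obtain ⟨g, t, t', hg, h1, h2⟩ := hQ (i ∘ₗ s ∘ₗ p + (LinearMap.id - i ∘ₗ p))
  have hg' : ∀ x, g (g x) = g x := fun x => LinearMap.congr_fun hg.eq x
  have h1' : ∀ x, g x = t (i (s (p x)) + (x - i (p x))) := fun x => LinearMap.congr_fun h1 x
  have h2' : ∀ x, x - g x = t' (x - (i (s (p x)) + (x - i (p x)))) :=
    fun x => LinearMap.congr_fun h2 x
  have h3 : ∀ x, g (x - i (p x)) = x - i (p x) := fun x => by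
    have := h2' (x - i (p x))
    simp only [map_sub, hpi, sub_self, map_zero, sub_zero, zero_add] at this
    rw [map_sub]
    exact (sub_eq_zero.1 this).symm
  have h4 : ∀ x, g (i (p x)) = g x - x + i (p x) := fun x => by
    have := h3 x
    rw [map_sub] at this
    rw [← sub_sub_cancel (g x) (g (i (p x))), this]; abel
  refine ⟨p ∘ₗ g ∘ₗ i, p ∘ₗ t ∘ₗ i, p ∘ₗ t' ∘ₗ i, ?_, ?_, ?_⟩
  · ext x
    simp [h4, hg', hpi]
  · ext x
    simp [h1', hpi]
  · ext x
    have := congrArg p (h2' (i x))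
    simpa [hpi] using this

theorem IsExchangeRing.of_linearEquiv (hB : IsExchangeRing (Module.End R B)) (e : A ≃ₗ[R] B) :
    IsExchangeRing (Module.End R A) :=
  hB.of_retract e.toLinearMap e.symm.toLinearMap (by ext; simp)

/-- In an exchange ring the two multipliers can be chosen in `e T` and `(1 - e) T`. -/
theorem IsExchangeRing.exists_normalized {T : Type*} [Ring T] (hT : IsExchangeRing T) (s : T) :
    ∃ e t t' : T, e * e = e ∧ t * s = e ∧ t' * (1 - s) = 1 - e ∧ e * t = t ∧
      (1 - e) * t' = t' := by
  obtain ⟨e, t, t', he, h1, h2⟩ := hT s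
  have he' : (1 - e) * (1 - e) = 1 - e := he.one_sub.eq
  refine ⟨e, e * t, (1 - e) * t', he.eq, ?_, ?_, ?_, ?_⟩
  · rw [mul_assoc, ← h1, he.eq]
  · rw [mul_assoc, ← h2, he']
  · rw [← mul_assoc, he.eq]
  · rw [← mul_assoc, he']

theorem IsExchangeRing.prod (hA : IsExchangeRing (Module.End R A))
    (hB : IsExchangeRing (Module.End R B)) : IsExchangeRing (Module.End R (A × B)) := by
  intro s
  set i₁ := LinearMap.inl R A B
  set p₁ := LinearMap.fst R A B
  set i₂ := LinearMap.inr R A B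
  set p₂ := LinearMap.snd R A B
  have h11 : ∀ x, p₁ (i₁ x) = x := fun x => rfl
  have h22 : ∀ x, p₂ (i₂ x) = x := fun x => rfl
  have h12 : ∀ x, p₁ (i₂ x) = 0 := fun x => rfl
  have h21 : ∀ x, p₂ (i₁ x) = 0 := fun x => rfl
  obtain ⟨e₁, t₁, t₁', he₁, h1, h1', ht₁, ht₁'⟩ := hA.exists_normalized (p₁ ∘ₗ s ∘ₗ i₁)
  replace he₁ : ∀ x, e₁ (e₁ x) = e₁ x := fun x => LinearMap.congr_fun he₁ x
  replace h1 : ∀ x, t₁ (p₁ (s (i₁ x))) = e₁ x := fun x => LinearMap.congr_fun h1 x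
  replace h1' : ∀ x, t₁' (x - p₁ (s (i₁ x))) = x - e₁ x := fun x => LinearMap.congr_fun h1' x
  replace ht₁ : ∀ x, e₁ (t₁ x) = t₁ x := fun x => LinearMap.congr_fun ht₁ x
  replace ht₁' : ∀ x, t₁' x - e₁ (t₁' x) = t₁' x := fun x => LinearMap.congr_fun ht₁' x
  set γ : Module.End R (A × B) := i₁ ∘ₗ t₁ ∘ₗ p₁ ∘ₗ s ∘ₗ i₂ ∘ₗ p₂ +
    i₁ ∘ₗ t₁' ∘ₗ p₁ ∘ₗ (1 - s) ∘ₗ i₂ ∘ₗ p₂ with hγ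
  have hp₂γ : ∀ x, p₂ (γ x) = 0 := fun x => by simp [hγ, h21]
  obtain ⟨e₂, t₂, t₂', he₂, h2, h2', ht₂, ht₂'⟩ :=
    hB.exists_normalized (p₂ ∘ₗ s ∘ₗ (LinearMap.id - γ) ∘ₗ i₂)
  replace he₂ : ∀ x, e₂ (e₂ x) = e₂ x := fun x => LinearMap.congr_fun he₂ x
  replace h2 : ∀ x, t₂ (p₂ (s (i₂ x - γ (i₂ x)))) = e₂ x := fun x => LinearMap.congr_fun h2 x
  replace h2' : ∀ x, t₂' (x - p₂ (s (i₂ x - γ (i₂ x)))) = x - e₂ x :=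
    fun x => LinearMap.congr_fun h2' x
  replace ht₂ : ∀ x, e₂ (t₂ x) = t₂ x := fun x => LinearMap.congr_fun ht₂ x
  replace ht₂' : ∀ x, t₂' x - e₂ (t₂' x) = t₂' x := fun x => LinearMap.congr_fun ht₂' x
  have hγ₂ : ∀ x, γ (i₂ (p₂ x)) = γ x := fun x => by simp [hγ, h22]
  refine exists_idempotent_of_corners (f := i₁ ∘ₗ p₁) (g := i₂ ∘ₗ p₂) (e₁ := i₁ ∘ₗ e₁ ∘ₗ p₁)
    (t₁ := i₁ ∘ₗ t₁ ∘ₗ p₁) (t₁' := i₁ ∘ₗ t₁' ∘ₗ p₁) (γ := γ) (e₂ := i₂ ∘ₗ e₂ ∘ₗ p₂)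
    (t₂ := i₂ ∘ₗ t₂ ∘ₗ p₂) (t₂' := i₂ ∘ₗ t₂' ∘ₗ p₂)
    ?_ ?_ ?_ ?_ ?_ ?_ ?_ ?_ ?_ ?_ ?_ ?_ ?_ ?_ ?_ ?_ ?_
  all_goals refine LinearMap.ext fun x => ?_
  · simp [h11]
  · simp [i₁, p₁, i₂, p₂]
  · simp [h11, he₁]
  · simp [h1]
  · have := congrArg i₁ (h1' (p₁ x))
    simpa [h11] using this
  · simp [h11, ht₁]
  · have := congrArg i₁ (ht₁' (p₁ x))
    simpa [h11] using this
  · simp [h11]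
  · simp [h11]
  · simp [hγ]
  · simp [h22, he₂]
  · have := congrArg i₂ (h2 (p₂ x))
    simpa [hγ₂] using this
  · have := congrArg i₂ (h2' (p₂ x))
    simpa [hγ₂, h22, hp₂γ] using this
  · simp [h22, ht₂]
  · have := congrArg i₂ (ht₂' (p₂ x))
    simpa [h22] using this
  · simp [h22]
  · simp [h22]

theorem IsExchangeRing.of_subsingleton (T : Type*) [Ring T] [Subsingleton T] : IsExchangeRing T :=
  fun _ => ⟨0, 0, 0, Subsingleton.elim _ _, Subsingleton.elim _ _, Subsingleton.elim _ _⟩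

theorem IsExchangeRing.pi_fin (hA : IsExchangeRing (Module.End R A)) (n : ℕ) :
    IsExchangeRing (Module.End R (Fin n → A)) := by
  induction n with
  | zero => exact .of_subsingleton _
  | succ n ih => exact (hA.prod ih).of_linearEquiv (Fin.consLinearEquiv R fun _ => A).symm

theorem IsLocalRing.isExchangeRing_end_self (S : Type*) [CommRing S] [IsLocalRing S] :
    IsExchangeRing (Module.End S S) := by
  intro s
  have key : ∀ f : Module.End S S, IsUnit (f 1) → ∃ g : Module.End S S, g * f = 1 := by
    rintro f ⟨u, hu⟩
    refine ⟨LinearMap.lsmul S S (↑u⁻¹ : S), ?_⟩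
    ext
    simp [← hu]
  rcases IsLocalRing.isUnit_or_isUnit_one_sub_self (s 1) with h | h
  · obtain ⟨g, hg⟩ := key s h
    exact ⟨1, g, 0, IsIdempotentElem.one, hg.symm, by simp⟩
  · obtain ⟨g, hg⟩ := key (1 - s) h
    exact ⟨0, 0, g, IsIdempotentElem.zero, by simp, by simp [hg]⟩

/-- An indecomposable module has only trivial idempotent endomorphisms, and an exchange ring with
only trivial idempotents is local. -/
theorem IsIndecomposableModule.isLocalRing_end (h : IsIndecomposableModule R A)
    (hA : IsExchangeRing (Module.End R A)) : IsLocalRing (Module.End R A) := by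
  obtain ⟨hnt, hind⟩ := h
  have triv : ∀ e : Module.End R A, IsIdempotentElem e → e = 0 ∨ e = 1 := by
    intro e he
    rcases hind _ _ (LinearMap.IsIdempotentElem.isCompl he) with h | h
    · exact .inl (LinearMap.range_eq_bot.1 h)
    · right
      ext x
      have : e (e x - x) = 0 := by
        have := LinearMap.congr_fun he.eq x
        simp only [Module.End.mul_apply] at this
        rw [map_sub, this, sub_self]
      have h2 := (LinearMap.ker_eq_bot'.1 h) _ this
      simpa [sub_eq_zero] using h2
  have unit : ∀ s t : Module.End R A, t * s = 1 → IsUnit s := by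
    intro s t hts
    rcases triv (s * t) (by
      change s * t * (s * t) = s * t
      rw [mul_assoc, ← mul_assoc t, hts, one_mul]) with h | h
    · exfalso
      have : t * (s * t) * s = 1 := by rw [← mul_assoc, hts, one_mul, hts]
      rw [h] at this
      simp at this
    · exact ⟨⟨s, t, h, hts⟩, rfl⟩
  have hnt' : Nontrivial (Module.End R A) := inferInstance
  refine ⟨fun {a b} hab => ?_⟩
  obtain ⟨e, t, t', he, h1, h2⟩ := hA a
  rcases triv e he with rfl | rfl
  · right
    rw [show b = 1 - a by rw [← hab]; abel]
    exact unit _ t' (by rw [← h2, sub_zero])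
  · exact .inl (unit _ t h1.symm)

end Module

/-! ### Direct summands of direct sums of modules with exchange endomorphism rings -/

section ExchangeModule

variable {R : Type*} [Ring R] {A M Z : Type*} [AddCommGroup A] [Module R A] [AddCommGroup M]
  [Module R M] [AddCommGroup Z] [Module R Z]

/-- The finite exchange property in terms of idempotents: if the summand `i(A)` of `M` has an
exchange endomorphism ring and `E` is an idempotent endomorphism of `M`, then the part of `E(M)`
inside `i(A)` is contained in a direct summand of `E(M)` which is a homomorphic image of `A`.
A suitable retraction `ψ` of `i`, one with `E`-stable kernel, gives this summand as the range of
`E i ψ E`. -/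
theorem exists_idempotent_range_le_of_exchange (hA : IsExchangeRing (Module.End R A))
    (i : A →ₗ[R] M) (p : M →ₗ[R] A) (hpi : p ∘ₗ i = LinearMap.id) {E : Module.End R M}
    (hE : E * E = E) :
    ∃ G : Module.End R M, G * G = G ∧ E * G = G ∧ G * E = G ∧
      (∃ q : M →ₗ[R] A, G = E ∘ₗ i ∘ₗ q) ∧ ∀ x ∈ LinearMap.range i, E x = x → G x = x := by
  have hE' : ∀ x, E (E x) = E x := fun x => LinearMap.congr_fun hE x
  have hpi' : ∀ x, p (i x) = x := fun x => LinearMap.congr_fun hpi x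
  obtain ⟨e, t, t', he, h1, h2, h3, h4⟩ := hA.exists_normalized (p ∘ₗ E ∘ₗ i)
  replace h1 : ∀ x, t (p (E (i x))) = e x := fun x => LinearMap.congr_fun h1 x
  replace h2 : ∀ x, t' (x - p (E (i x))) = x - e x := fun x => LinearMap.congr_fun h2 x
  replace h3 : ∀ x, e (t x) = t x := fun x => LinearMap.congr_fun h3 x
  replace h4 : ∀ x, e (t' x) = 0 := fun x => by
    have := LinearMap.congr_fun h4 x
    simpa using this
  set ψ : M →ₗ[R] A := t ∘ₗ p ∘ₗ E + t' ∘ₗ p ∘ₗ (LinearMap.id - E) with hψ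
  have hψi : ∀ a, ψ (i a) = a := fun a => by
    have := h2 a
    simp only [hψ, LinearMap.add_apply, LinearMap.comp_apply, LinearMap.sub_apply,
      LinearMap.id_apply, map_sub p, hpi', h1, this]
    abel
  have hψE : ∀ x, ψ (E x) = t (p (E x)) := fun x => by simp [hψ, hE']
  have hψE' : ∀ x, ψ (E (i (ψ x))) = ψ (E x) := fun x => by
    rw [hψE, hψE, h1]
    simp [hψ, h3, h4]
  refine ⟨E ∘ₗ i ∘ₗ ψ ∘ₗ E, ?_, ?_, ?_, ⟨ψ ∘ₗ E, rfl⟩, ?_⟩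
  · ext x; simp [hE', hψE']
  · ext x; simp [hE']
  · ext x; simp [hE']
  · rintro _ ⟨a, rfl⟩ h
    simp [h, hψi]

/-- The submodule `N` is the internal direct sum of a set of finitely generated submodules. -/
def Submodule.IsSumOfFG (N : Submodule R M) : Prop :=
  ∃ 𝒜 : Set (Submodule R M), sSupIndep 𝒜 ∧ sSup 𝒜 = N ∧ ∀ A ∈ 𝒜, A.FG

/-- Every finitely generated submodule of `M` lies in a direct summand of `M` isomorphic to a finite
direct power of `Z`. -/
def IsLocallyPower (R : Type*) [Ring R] (Z M : Type*) [AddCommGroup Z] [Module R Z]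
    [AddCommGroup M] [Module R M] : Prop :=
  ∀ B : Submodule R M, B.FG → ∃ (n : ℕ) (i : (Fin n → Z) →ₗ[R] M) (p : M →ₗ[R] (Fin n → Z)),
    p ∘ₗ i = LinearMap.id ∧ B ≤ LinearMap.range i

theorem isLocallyPower_finsupp (I : Type*) : IsLocallyPower R Z (I →₀ Z) := by
  classical
  rintro B ⟨S, rfl⟩
  set F : Finset I := S.biUnion Finsupp.support with hF
  set g : Fin F.card → I := fun k => (F.equivFin.symm k : I) with hg
  have hginj : Function.Injective g := Subtype.val_injective.comp F.equivFin.symm.injective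
  refine ⟨F.card, Finsupp.lmapDomain Z R g ∘ₗ
    (Finsupp.linearEquivFunOnFinite R Z (Fin F.card)).symm.toLinearMap,
    (Finsupp.linearEquivFunOnFinite R Z _).toLinearMap ∘ₗ Finsupp.lcomapDomain g hginj, ?_, ?_⟩
  · refine LinearMap.ext fun v => ?_
    simp only [LinearMap.comp_apply, LinearEquiv.coe_coe, Finsupp.lmapDomain_apply,
      Finsupp.leftInverse_lcomapDomain_mapDomain g hginj _, LinearEquiv.apply_symm_apply,
      LinearMap.id_apply]
  · rw [Submodule.span_le]
    intro x hx
    refine ⟨Finsupp.linearEquivFunOnFinite R Z _ (Finsupp.comapDomain g x hginj.injOn), ?_⟩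
    simp only [LinearMap.comp_apply, LinearEquiv.coe_coe, LinearEquiv.symm_apply_apply,
      Finsupp.lmapDomain_apply]
    refine Finsupp.mapDomain_comapDomain g hginj x fun j hj => ?_
    have : j ∈ F := Finset.mem_biUnion.2 ⟨x, hx, hj⟩
    exact ⟨F.equivFin ⟨j, this⟩, by simp [hg]⟩

/-- A countably generated direct summand of `M` is exhausted by an increasing sequence of finitely
generated direct summands; successive complements decompose it. -/
theorem isSumOfFG_range_of_countable [Module.Finite R Z]
    (hZ : IsExchangeRing (Module.End R Z)) (hM : IsLocallyPower R Z M) {E : Module.End R M}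
    (hE : E * E = E) (x : ℕ → M) (hx : LinearMap.range E = Submodule.span R (Set.range x)) :
    (LinearMap.range E).IsSumOfFG := by
  have step : ∀ (y : M) (G : {G : Module.End R M // G * G = G ∧ E * G = G ∧
      (LinearMap.range G).FG}), ∃ G' : {G : Module.End R M // G * G = G ∧ E * G = G ∧
      (LinearMap.range G).FG}, G'.1 * G.1 = G.1 ∧ (E y = y → G'.1 y = y) := by
    rintro y ⟨G, hG, hEG, hfg⟩
    obtain ⟨n, i, p, hpi, hle⟩ := hM (LinearMap.range G ⊔ Submodule.span R {y})
      (hfg.sup (Submodule.fg_span_singleton y))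
    obtain ⟨G', h1, h2, -, ⟨q, hq⟩, h4⟩ :=
      exists_idempotent_range_le_of_exchange (hZ.pi_fin n) i p hpi hE
    have hfg' : (LinearMap.range G').FG := by
      -- the range of `G'` is a homomorphic image of a finite power of `Z`
      have : LinearMap.range G' = LinearMap.range (G' ∘ₗ E ∘ₗ i) := by
        refine le_antisymm ?_ (LinearMap.range_comp_le_range _ _)
        rintro _ ⟨z, rfl⟩
        refine ⟨q z, ?_⟩
        have e1 := LinearMap.congr_fun h1 z
        have e2 := LinearMap.congr_fun hq z
        simp only [LinearMap.comp_apply, Module.End.mul_apply] at e1 e2 ⊢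
        rw [← e2, e1]
      rw [this]
      exact Module.Finite.iff_fg.1 inferInstance
    refine ⟨⟨G', h1, h2, hfg'⟩, ?_, fun hy => ?_⟩
    · ext z
      exact h4 _ (hle (Submodule.mem_sup_left ⟨z, rfl⟩)) (LinearMap.congr_fun hEG z)
    · exact h4 _ (hle (Submodule.mem_sup_right (Submodule.mem_span_singleton_self y))) hy
  choose next hnext1 hnext2 using step
  let G : ℕ → {G : Module.End R M // G * G = G ∧ E * G = G ∧ (LinearMap.range G).FG} := fun n =>
    Nat.rec ⟨0, by simp, by simp, by simp [Submodule.fg_bot]⟩ (fun n G => next (x n) G) n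
  have hGs : ∀ n, G (n + 1) = next (x n) (G n) := fun n => rfl
  have hidem : ∀ n z, (G n).1 ((G n).1 z) = (G n).1 z := fun n => LinearMap.congr_fun (G n).2.1
  have hsucc : ∀ n z, (G (n + 1)).1 ((G n).1 z) = (G n).1 z := fun n => by
    rw [hGs]; exact LinearMap.congr_fun (hnext1 _ _)
  have hmono : Monotone fun n => LinearMap.range (G n).1 := by
    refine monotone_nat_of_le_succ fun n => ?_
    rintro _ ⟨z, rfl⟩
    exact ⟨_, hsucc n z⟩
  have hEx : ∀ n, E (x n) = x n := fun n => by
    have : x n ∈ LinearMap.range E := hx ▸ Submodule.subset_span ⟨n, rfl⟩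
    obtain ⟨z, hz⟩ := this
    rw [← hz]; exact LinearMap.congr_fun hE z
  set C : ℕ → Submodule R M := fun n => LinearMap.range (G (n + 1)).1 ⊓ LinearMap.ker (G n).1
    with hC
  have hCle : ∀ n, LinearMap.range (G n).1 ≤ ⨆ n, C n := by
    intro n
    induction n with
    | zero => rintro _ ⟨z, rfl⟩; exact Submodule.zero_mem _
    | succ n ih =>
      rintro _ ⟨z, rfl⟩
      rw [← add_sub_cancel ((G n).1 ((G (n + 1)).1 z)) ((G (n + 1)).1 z)]
      refine Submodule.add_mem _ (ih ⟨_, rfl⟩) (Submodule.mem_iSup_of_mem n ⟨?_, ?_⟩)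
      · exact Submodule.sub_mem _ ⟨_, rfl⟩ (hmono (Nat.le_succ n) ⟨_, rfl⟩)
      · simp [hidem]
  refine ⟨Set.range C, ?_, ?_, ?_⟩
  · refine iSupIndep.sSupIndep_range ?_
    rw [iSupIndep_iff_finsetSum_eq_zero_imp_eq_zero]
    intro s
    induction s using Finset.induction_on_max with
    | empty => simp
    | insert a s hs ih =>
      intro v hsum hv
      have ha : a ∉ s := fun h => lt_irrefl _ (hs a h)
      rw [Finset.sum_insert ha] at hv
      have hmem : ∑ k ∈ s, v k ∈ LinearMap.range (G a).1 :=
        Submodule.sum_mem _ fun k hk =>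
          hmono (Nat.succ_le_of_lt (hs k hk)) (hsum k (Finset.mem_insert_of_mem hk)).1
      have hker : (G a).1 (v a) = 0 := (hsum a (Finset.mem_insert_self _ _)).2
      have h0 : ∑ k ∈ s, v k = 0 := by
        obtain ⟨z, hz⟩ := hmem
        have := congrArg (G a).1 hv
        rw [map_add, hker, zero_add, ← hz, hidem, map_zero] at this
        rw [← hz, this]
      have hva : v a = 0 := by rwa [h0, add_zero] at hv
      intro k hk
      rcases Finset.mem_insert.1 hk with rfl | hk
      · exact hva
      · exact ih v (fun k hk => hsum k (Finset.mem_insert_of_mem hk)) h0 k hk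
  · rw [sSup_range]
    refine le_antisymm (iSup_le fun n => inf_le_left.trans ?_) ?_
    · rintro _ ⟨z, rfl⟩
      exact ⟨_, LinearMap.congr_fun (G (n + 1)).2.2.1 z⟩
    · rw [hx, Submodule.span_le]
      rintro _ ⟨n, rfl⟩
      exact hCle (n + 1) ⟨x n, by rw [hGs]; exact hnext2 _ _ (hEx n)⟩
  · rintro _ ⟨n, rfl⟩
    have : C n = (LinearMap.range (G (n + 1)).1).map (LinearMap.id - (G n).1) := by
      refine le_antisymm ?_ ?_
      · rintro z ⟨hz1, hz2⟩
        exact ⟨z, hz1, by simpa using hz2⟩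
      · rintro _ ⟨z, hz, rfl⟩
        refine ⟨Submodule.sub_mem _ hz (hmono (Nat.le_succ n) ⟨_, rfl⟩), by simp [hidem]⟩
    rw [this]
    exact (G (n + 1)).2.2.2.map _

theorem sSupIndep_union_of_disjoint {N N' : Submodule R M} {𝒜 ℬ : Set (Submodule R M)}
    (h1 : sSupIndep 𝒜) (h1' : sSup 𝒜 = N) (h2 : sSupIndep ℬ) (h2' : sSup ℬ = N')
    (hd : Disjoint N N') : sSupIndep (𝒜 ∪ ℬ) := by
  have key : ∀ (𝒜 ℬ : Set (Submodule R M)), sSupIndep 𝒜 → Disjoint (sSup 𝒜) (sSup ℬ) →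
      ∀ a ∈ 𝒜, Disjoint a (sSup ((𝒜 ∪ ℬ) \ {a})) := by
    intro 𝒜 ℬ h hd a ha
    have h3 : Disjoint a (sSup (𝒜 \ {a}) ⊔ sSup ℬ) :=
      (h ha).disjoint_sup_right_of_disjoint_sup_left
        (hd.mono_left (sup_le (le_sSup ha) (sSup_le_sSup Set.sdiff_subset)))
    refine h3.mono_right ?_
    rw [Set.union_sdiff_distrib, sSup_union]
    exact sup_le_sup_left (sSup_le_sSup Set.sdiff_subset) _
  subst h1' h2'
  rintro a (ha | ha)
  · exact key 𝒜 ℬ h1 hd a ha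
  · rw [Set.union_comm]
    exact key ℬ 𝒜 h2 hd.symm a ha

end ExchangeModule

section Kaplansky

variable {R : Type*} [Ring R] {Z : Type*} [AddCommGroup Z] [Module R Z] {I : Type*}

/-- Every index lies in a countable set of indices `J` such that the submodule of elements supported
on `J` is stable under the given endomorphism. -/
theorem exists_countable_supported_stable [Module.Finite R Z] (E : Module.End R (I →₀ Z)) (i : I) :
    ∃ J : Set I, J.Countable ∧ i ∈ J ∧
      Finsupp.supported Z R J ≤ (Finsupp.supported Z R J).comap E := by
  classical
  obtain ⟨S, hS⟩ := (Module.Finite.fg_top : (⊤ : Submodule R Z).FG)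
  set c : I → Set I := fun j => ⋃ z ∈ S, ((E (Finsupp.single j z)).support : Set I) with hc
  have hcE : ∀ j z, E (Finsupp.single j z) ∈ Finsupp.supported Z R (c j) := by
    intro j z
    have : (⊤ : Submodule R Z) ≤
        (Finsupp.supported Z R (c j)).comap (E ∘ₗ Finsupp.lsingle j) := by
      rw [← hS, Submodule.span_le]
      intro z hz
      change (((E (Finsupp.single j z)).support : Set I)) ⊆ c j
      exact Set.subset_biUnion_of_mem (u := fun z => ((E (Finsupp.single j z)).support : Set I)) hz
    exact this (Submodule.mem_top (x := z))
  have hcc : ∀ j, (c j).Countable := fun j =>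
    S.countable_toSet.biUnion fun z _ => Finset.countable_toSet _
  let D : ℕ → Set I := fun n => Nat.rec {i} (fun _ D => ⋃ j ∈ D, c j) n
  have hDc : ∀ n, (D n).Countable := by
    intro n
    induction n with
    | zero => exact Set.countable_singleton i
    | succ n ih => exact ih.biUnion fun j _ => hcc j
  refine ⟨⋃ n, D n, Set.countable_iUnion hDc, Set.mem_iUnion.2 ⟨0, rfl⟩, ?_⟩
  intro x hx
  rw [Submodule.mem_comap, ← Finsupp.sum_single x, Finsupp.sum, map_sum]
  refine Submodule.sum_mem _ fun j hj => ?_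
  obtain ⟨n, hn⟩ := Set.mem_iUnion.1 (hx hj)
  refine Finsupp.supported_mono ?_ (hcE j (x j))
  refine Set.Subset.trans ?_ (Set.subset_iUnion D (n + 1))
  exact Set.subset_biUnion_of_mem (u := c) hn

/-- The extension step of Kaplansky's dévissage: if the elements supported on `J` and on the
countable set `J₀` form `E`-stable submodules, then `E(M_J)` has in `E(M_{J ∪ J₀})` a countably
generated complement, which is itself a direct summand of the whole module. -/
theorem exists_isSumOfFG_complement [Module.Finite R Z] (hZ : IsExchangeRing (Module.End R Z))
    {E : Module.End R (I →₀ Z)} (hE : E * E = E) {J J₀ : Set I} (hJ₀ : J₀.Countable)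
    (hJE : Finsupp.supported Z R J ≤ (Finsupp.supported Z R J).comap E)
    (hJE₀ : Finsupp.supported Z R J₀ ≤ (Finsupp.supported Z R J₀).comap E) :
    ∃ Q : Submodule R (I →₀ Z), Q.IsSumOfFG ∧
      Disjoint ((Finsupp.supported Z R J).map E) Q ∧
      (Finsupp.supported Z R J).map E ⊔ Q = (Finsupp.supported Z R (J ∪ J₀)).map E := by
  classical
  have hE' : ∀ x, E (E x) = E x := fun x => LinearMap.congr_fun hE x
  set MJ := Finsupp.supported Z R J with hMJ
  set M' := Finsupp.supported Z R (J ∪ J₀) with hM'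
  have hMM' : MJ ≤ M' := Finsupp.supported_mono Set.subset_union_left
  have hM'E : ∀ x ∈ M', E x ∈ M' := by
    intro x hx
    rw [hM', Finsupp.supported_union] at hx ⊢
    obtain ⟨y, hy, z, hz, rfl⟩ := Submodule.mem_sup.1 hx
    rw [map_add]
    exact Submodule.add_mem_sup (hJE hy) (hJE₀ hz)
  set π : Module.End R (I →₀ Z) := MJ.subtype ∘ₗ Finsupp.restrictDom Z R J with hπ
  set π' : Module.End R (I →₀ Z) := M'.subtype ∘ₗ Finsupp.restrictDom Z R (J ∪ J₀) with hπ'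
  have hπmem : ∀ x, π x ∈ MJ := fun x => (Finsupp.restrictDom Z R J x).2
  have hπ'mem : ∀ x, π' x ∈ M' := fun x => (Finsupp.restrictDom Z R (J ∪ J₀) x).2
  have hπid : ∀ x ∈ MJ, π x = x := fun x hx =>
    congrArg Subtype.val (LinearMap.congr_fun (Finsupp.restrictDom_comp_subtype J) ⟨x, hx⟩)
  have hπ'id : ∀ x ∈ M', π' x = x := fun x hx =>
    congrArg Subtype.val (LinearMap.congr_fun (Finsupp.restrictDom_comp_subtype (J ∪ J₀)) ⟨x, hx⟩)
  set E₂ : Module.End R (I →₀ Z) := E - E ∘ₗ π ∘ₗ E with hE₂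
  have hE₂app : ∀ x, E₂ x = E x - E (π (E x)) := fun x => rfl
  have hE₂J : ∀ x ∈ MJ, E₂ x = 0 := fun x hx => by
    rw [hE₂app, hπid _ (hJE hx), hE', sub_self]
  have hE₂E : ∀ x, E₂ (E x) = E₂ x := fun x => by simp [hE₂app, hE']
  have hE₂M' : ∀ x ∈ M', E₂ x ∈ M' := fun x hx => by
    rw [hE₂app]
    exact Submodule.sub_mem _ (hM'E _ hx) (hM'E _ (hMM' (hπmem _)))
  have hE₂E₂ : ∀ x, E₂ (E₂ x) = E₂ x := fun x => by
    conv_lhs => rw [hE₂app x, map_sub, hE₂E, hE₂E, hE₂J _ (hπmem _), sub_zero]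
  set G : Module.End R (I →₀ Z) := E₂ ∘ₗ π' with hG
  have hGG : G * G = G := by
    refine LinearMap.ext fun x => ?_
    simp only [hG, Module.End.mul_apply, LinearMap.comp_apply]
    rw [hπ'id _ (hE₂M' _ (hπ'mem _)), hE₂E₂]
  obtain ⟨S, hS⟩ := (Module.Finite.fg_top : (⊤ : Submodule R Z).FG)
  set X : Set (I →₀ Z) := insert 0 (⋃ j ∈ J₀, (fun z => E₂ (Finsupp.single j z)) '' S) with hX
  have hXc : X.Countable :=
    (hJ₀.biUnion fun j _ => (S.countable_toSet.image _)).insert 0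
  obtain ⟨x, hx⟩ := hXc.exists_eq_range ⟨0, Set.mem_insert _ _⟩
  have hspan : LinearMap.range G = Submodule.span R (Set.range x) := by
    rw [← hx]
    refine le_antisymm ?_ ?_
    · rintro _ ⟨y, rfl⟩
      have hy := hπ'mem y
      rw [hM', Finsupp.supported_union] at hy
      obtain ⟨a, ha, b, hb, hab⟩ := Submodule.mem_sup.1 hy
      rw [hG, LinearMap.comp_apply, ← hab, map_add, hE₂J a ha, zero_add, ← Finsupp.sum_single b,
        Finsupp.sum, map_sum]
      refine Submodule.sum_mem _ fun j hj => ?_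
      have : (⊤ : Submodule R Z) ≤ (Submodule.span R X).comap (E₂ ∘ₗ Finsupp.lsingle j) := by
        rw [← hS, Submodule.span_le]
        intro z hz
        refine Submodule.subset_span (Set.mem_insert_of_mem _ ?_)
        exact Set.mem_biUnion (hb hj) ⟨z, hz, rfl⟩
      exact this (Submodule.mem_top (x := b j))
    · rw [Submodule.span_le]
      rintro _ (rfl | hy)
      · exact Submodule.zero_mem _
      · obtain ⟨j, hj, z, -, rfl⟩ := Set.mem_iUnion₂.1 hy
        refine ⟨Finsupp.single j z, ?_⟩
        rw [hG, LinearMap.comp_apply, hπ'id]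
        exact Finsupp.single_mem_supported R z (Set.mem_union_right _ hj)
  refine ⟨LinearMap.range G,
    isSumOfFG_range_of_countable hZ (isLocallyPower_finsupp I) hGG x hspan, ?_, ?_⟩
  · rw [Submodule.disjoint_def]
    rintro _ ⟨y, hy, rfl⟩ ⟨z, hz⟩
    rw [← hz, hG, LinearMap.comp_apply, ← hE₂E₂]
    rw [hG, LinearMap.comp_apply] at hz
    rw [hz, hE₂E, hE₂J y hy]
  · refine le_antisymm (sup_le (Submodule.map_mono hMM') ?_) ?_
    · rintro _ ⟨z, rfl⟩
      refine ⟨G z, hE₂M' _ (hπ'mem _), ?_⟩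
      rw [hG, LinearMap.comp_apply, hE₂app, map_sub, hE', hE']
    · rintro _ ⟨z, hz, rfl⟩
      rw [← add_sub_cancel (E (π (E z))) (E z), ← hE₂app]
      refine Submodule.add_mem_sup ⟨_, hπmem _, rfl⟩ ⟨z, ?_⟩
      rw [hG, LinearMap.comp_apply, hπ'id z hz]

/-- A direct summand of an arbitrary direct sum of copies of a finitely generated module with
exchange endomorphism ring is a direct sum of finitely generated modules. -/
theorem isSumOfFG_range [Module.Finite R Z] (hZ : IsExchangeRing (Module.End R Z))
    {E : Module.End R (I →₀ Z)} (hE : E * E = E) : (LinearMap.range E).IsSumOfFG := by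
  classical
  -- maximal partial decompositions, indexed by `E`-stable sets of coordinates
  obtain ⟨⟨J, 𝒜⟩, ⟨hJ, hind, hsup, hfg⟩, hmax⟩ := zorn_le₀
    {P : Set I × Set (Submodule R (I →₀ Z)) |
      Finsupp.supported Z R P.1 ≤ (Finsupp.supported Z R P.1).comap E ∧ sSupIndep P.2 ∧
      sSup P.2 = (Finsupp.supported Z R P.1).map E ∧ ∀ A ∈ P.2, A.FG} (by
    intro c hcs hc
    refine ⟨(⋃ P : c, P.1.1, ⋃ P : c, P.1.2), ⟨?_, ?_, ?_, ?_⟩, fun P hP => ⟨?_, ?_⟩⟩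
    · simp only [Finsupp.supported_iUnion]
      exact iSup_le fun P => (hcs P.2).1.trans (Submodule.comap_mono (le_iSup
        (fun P : c => Finsupp.supported Z R P.1.1) P))
    · refine sSupIndep_iUnion_of_directed ?_ fun P => (hcs P.2).2.1
      intro P Q
      rcases hc.total P.2 Q.2 with h | h
      · exact ⟨Q, h.2, subset_rfl⟩
      · exact ⟨P, subset_rfl, h.2⟩
    · simp only [Finsupp.supported_iUnion, Submodule.map_iSup, sSup_iUnion]
      exact iSup_congr fun P => (hcs P.2).2.2.1
    · intro A hA
      obtain ⟨P, hP⟩ := Set.mem_iUnion.1 hA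
      exact (hcs P.2).2.2.2 A hP
    · exact Set.subset_iUnion (fun P : c => P.1.1) ⟨P, hP⟩
    · exact Set.subset_iUnion (fun P : c => P.1.2) ⟨P, hP⟩)
  have hJu : J = Set.univ := by
    by_contra hne
    obtain ⟨i, hi⟩ := (Set.ne_univ_iff_exists_notMem J).1 hne
    obtain ⟨J₀, hc, hi₀, hJ₀⟩ := exists_countable_supported_stable E i
    obtain ⟨Q, ⟨ℬ, hB1, hB2, hB3⟩, hd, hs⟩ := exists_isSumOfFG_complement hZ hE hc hJ hJ₀
    refine hi ((hmax (y := (J ∪ J₀, 𝒜 ∪ ℬ)) ⟨?_, ?_, ?_, ?_⟩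
      ⟨Set.subset_union_left, Set.subset_union_left⟩).1 (Set.mem_union_right _ hi₀))
    · simp only [Finsupp.supported_union]
      exact sup_le (hJ.trans (Submodule.comap_mono le_sup_left))
        (hJ₀.trans (Submodule.comap_mono le_sup_right))
    · exact sSupIndep_union_of_disjoint hind hsup hB1 hB2 hd
    · simp only [sSup_union]
      rw [← hs, hB2]
      exact congrArg (· ⊔ Q) hsup
    · rintro A (hA | hA)
      exacts [hfg A hA, hB3 A hA]
  refine ⟨𝒜, hind, ?_, hfg⟩
  change sSup 𝒜 = Submodule.map E (Finsupp.supported Z R J) at hsup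
  rw [hsup, hJu, Finsupp.supported_univ, Submodule.map_top]

end Kaplansky

/-- Decompositions into finitely generated submodules transfer along injective maps. -/
theorem Submodule.IsSumOfFG.isDirectSumOfFG {R : Type u} [Ring R] {N : Type w} [AddCommGroup N]
    [Module R N] {M : Type v} [AddCommGroup M] [Module R M] (i : N →ₗ[R] M)
    (hi : Function.Injective i) (h : (LinearMap.range i).IsSumOfFG) : IsDirectSumOfFG R N := by
  classical
  obtain ⟨𝒜, hind, hsup, hfg⟩ := h
  have hle : ∀ A ∈ 𝒜, A ≤ LinearMap.range i := fun A hA => hsup ▸ le_sSup hA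
  have hmap : ∀ A ∈ 𝒜, (A.comap i).map i = A := fun A hA => by
    rw [Submodule.map_comap_eq, inf_eq_right.2 (hle A hA)]
  refine ⟨{B : Submodule R N // B.map i ∈ 𝒜}, inferInstance, fun B => B.1, ?_, fun B => ?_⟩
  · rw [DirectSum.isInternal_submodule_iff_iSupIndep_and_iSup_eq_top]
    constructor
    · intro B
      rw [Submodule.disjoint_def]
      intro x hx hx'
      have h1 : i x ∈ sSup (𝒜 \ {B.1.map i}) := by
        have h2 : i x ∈ (⨆ (C : {B : Submodule R N // B.map i ∈ 𝒜}) (_ : C ≠ B), C.1).map i :=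
          ⟨x, hx', rfl⟩
        simp only [Submodule.map_iSup] at h2
        refine (iSup₂_le fun C hC => ?_ : _ ≤ sSup (𝒜 \ {B.1.map i})) h2
        refine le_sSup ⟨C.2, fun h => hC (Subtype.ext ?_)⟩
        exact Submodule.map_injective_of_injective hi h
      have h3 := Submodule.disjoint_def.1 (hind B.2) (i x) ⟨x, hx, rfl⟩ h1
      exact hi (by rw [h3, map_zero])
    · refine eq_top_iff.2 fun x _ => ?_
      have h1 : i x ∈ sSup 𝒜 := hsup ▸ ⟨x, rfl⟩
      have h2 : sSup 𝒜 ≤ (⨆ B : {B : Submodule R N // B.map i ∈ 𝒜}, B.1).map i := by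
        refine sSup_le fun A hA => ?_
        rw [← hmap A hA]
        exact Submodule.map_mono (le_iSup (fun B : {B : Submodule R N // B.map i ∈ 𝒜} => B.1)
          ⟨A.comap i, by rwa [hmap A hA]⟩)
      obtain ⟨y, hy, hyx⟩ := h2 h1
      rwa [← hi hyx]
  · exact Submodule.fg_of_fg_map_injective i hi (hfg _ B.2)

section Add

variable {R : Type u} [Ring R] {Z : Type v} [AddCommGroup Z] [Module R Z]
  {N : Type w} [AddCommGroup N] [Module R N]

theorem MemAdd.isDirectSumOfFG [Module.Finite R Z] (hZ : IsExchangeRing (Module.End R Z))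
    (h : MemAdd R Z N) : IsDirectSumOfFG R N := by
  obtain ⟨I, i, p, hpi⟩ := h
  have hpi' : ∀ x, p (i x) = x := fun x => LinearMap.congr_fun hpi x
  have hrange : LinearMap.range (i ∘ₗ p) = LinearMap.range i := by
    rw [LinearMap.range_comp, LinearMap.range_eq_top.2 fun x => ⟨i x, hpi' x⟩, Submodule.map_top]
  refine Submodule.IsSumOfFG.isDirectSumOfFG i (Function.LeftInverse.injective hpi') ?_
  rw [← hrange]
  exact isSumOfFG_range hZ (E := i ∘ₗ p) (LinearMap.ext fun x => by simp [hpi'])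

theorem MemAdd.isExchangeRing_end [Module.Finite R N] (hZ : IsExchangeRing (Module.End R Z))
    (h : MemAdd R Z N) : IsExchangeRing (Module.End R N) := by
  obtain ⟨I, i, p, hpi⟩ := h
  have hpi' : ∀ x, p (i x) = x := fun x => LinearMap.congr_fun hpi x
  obtain ⟨n, j, q, hqj, hle⟩ := isLocallyPower_finsupp (R := R) (Z := Z) I (LinearMap.range i)
    (Module.Finite.iff_fg.1 inferInstance)
  refine (hZ.pi_fin n).of_retract (q ∘ₗ i) (p ∘ₗ j) (LinearMap.ext fun x => ?_)
  obtain ⟨y, hy⟩ := hle ⟨x, rfl⟩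
  have := LinearMap.congr_fun hqj y
  simp only [LinearMap.comp_apply, LinearMap.id_apply] at this ⊢
  rw [← hy, this, hy, hpi']

end Add

/-! ### Realizing an endomorphism as a corner of an idempotent -/

section Corner

variable {R : Type*} [Ring R] {X F : Type*} [AddCommGroup X] [Module R X] [AddCommGroup F]
  [Module R F]

/-- If `h - h² = a b` factors through `F`, then `h` is the `X`-corner of an idempotent endomorphism
of `P = X ⊕ F^(ω) ⊕ F^(ω)`.

The range of this idempotent is the colimit `L` of the sequence `X → X ⊕ F → X ⊕ F² → ⋯` whose maps
send `(x, v)` to `(h x, b x, v)`. With `c k : X → L` and `d k : F → L` the canonical maps, `L` is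
generated by the images of `c 0`, `d k` and `c k ∘ a`, which gives a surjection `P → L`. Maps `θ k`
lifting `c k` along it are defined recursively; they are compatible up to the errors `δ k`, and
correcting for the accumulated errors yields compatible lifts `σ k`, `τ k` of `c k` and `d k`, that
is, a section `L → P`. The idempotent is the composite `P → L → P`, and the colimit itself need not
appear. -/
theorem exists_idempotent_corner_of_factor (h : X →ₗ[R] X) (b : X →ₗ[R] F) (a : F →ₗ[R] X)
    (hab : ∀ x, a (b x) = h x - h (h x)) :
    ∃ E : Module.End R (X × ((ℕ →₀ F) × (ℕ →₀ F))), E * E = E ∧ ∀ x, (E (x, 0)).1 = h x := by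
  let C : X →ₗ[R] X × ((ℕ →₀ F) × (ℕ →₀ F)) := LinearMap.inl R _ _
  let D : ℕ → F →ₗ[R] X × ((ℕ →₀ F) × (ℕ →₀ F)) := fun k =>
    LinearMap.inr R _ _ ∘ₗ LinearMap.inl R _ _ ∘ₗ Finsupp.lsingle k
  let A : ℕ → F →ₗ[R] X × ((ℕ →₀ F) × (ℕ →₀ F)) := fun k =>
    LinearMap.inr R _ _ ∘ₗ LinearMap.inr R _ _ ∘ₗ Finsupp.lsingle k
  let θ : ℕ → X →ₗ[R] X × ((ℕ →₀ F) × (ℕ →₀ F)) := fun k => Nat.rec C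
    (fun k t => t + A (k + 2) ∘ₗ b + D (k + 2) ∘ₗ b ∘ₗ (LinearMap.id - h) - D (k + 1) ∘ₗ b) k
  let δ : ℕ → X →ₗ[R] X × ((ℕ →₀ F) × (ℕ →₀ F)) := fun k =>
    θ k - θ (k + 1) ∘ₗ h - D (k + 1) ∘ₗ b
  let S : ℕ → X →ₗ[R] X × ((ℕ →₀ F) × (ℕ →₀ F)) := fun k => Nat.rec 0
    (fun k t => t + δ (k + 1)) k
  let σ : ℕ → X →ₗ[R] X × ((ℕ →₀ F) × (ℕ →₀ F)) := fun k =>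
    θ (k + 1) ∘ₗ h + D (k + 1) ∘ₗ b + S k ∘ₗ h
  let τ : ℕ → F →ₗ[R] X × ((ℕ →₀ F) × (ℕ →₀ F)) := fun k => D k + S k ∘ₗ a
  let E : Module.End R (X × ((ℕ →₀ F) × (ℕ →₀ F))) :=
    (σ 0).coprod ((Finsupp.lsum ℕ τ).coprod (Finsupp.lsum ℕ fun k => σ k ∘ₗ a))
  have hEC : ∀ x, E (C x) = σ 0 x := fun x => by simp [E, C]
  have hED : ∀ k v, E (D k v) = τ k v := fun k v => by simp [E, D]
  have hEA : ∀ k v, E (A k v) = σ k (a v) := fun k v => by simp [E, A]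
  have hθ : ∀ k x, θ (k + 1) x = θ k x + A (k + 2) (b x) + D (k + 2) (b (x - h x)) -
      D (k + 1) (b x) :=
    fun k x => rfl
  have hδ : ∀ k x, δ k x = θ k x - θ (k + 1) (h x) - D (k + 1) (b x) := fun k x => rfl
  have hS : ∀ k x, S (k + 1) x = S k x + δ (k + 1) x := fun k x => rfl
  have hσ : ∀ k x, σ k x = θ (k + 1) (h x) + D (k + 1) (b x) + S k (h x) := fun k x => rfl
  have hτ : ∀ k v, τ k v = D k v + S k (a v) := fun k v => rfl
  have hD1 : ∀ k v, (D k v).1 = 0 := fun k v => rfl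
  have hA1 : ∀ k v, (A k v).1 = 0 := fun k v => rfl
  have hθ0 : ∀ x, θ 0 x = C x := fun x => rfl
  have hθ1 : ∀ x, (θ 0 x).1 = x := fun x => rfl
  have hS0 : ∀ x, S 0 x = 0 := fun x => rfl
  have hext : ∀ f : Module.End R (X × ((ℕ →₀ F) × (ℕ →₀ F))), (∀ x, f (C x) = E (C x)) →
      (∀ k v, f (D k v) = E (D k v)) → (∀ k v, f (A k v) = E (A k v)) → f = E := by
    intro f h1 h2 h3
    refine LinearMap.prod_ext (LinearMap.ext h1) (LinearMap.prod_ext ?_ ?_)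
    · exact Finsupp.lhom_ext h2
    · exact Finsupp.lhom_ext h3
  have hCx : ∀ x, C x = (x, 0) := fun x => rfl
  clear_value E τ σ S δ θ A D C
  -- compatibility with the transition maps of the colimit
  have hστ : ∀ k x, σ k x = σ (k + 1) (h x) + τ (k + 1) (b x) := fun k x => by
    have h1 : S (k + 1) (h (h x)) + S (k + 1) (a (b x)) = S (k + 1) (h x) := by
      rw [← map_add, hab, add_sub_cancel]
    have h2 : S (k + 1) (a (b x)) = S (k + 1) (h x) - S (k + 1) (h (h x)) := by rw [← h1]; abel
    rw [hσ (k + 1), hτ, h2, hS k (h x), hδ (k + 1) (h x), hσ k]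
    abel
  have hEθ : ∀ k x, E (θ k x) = σ k x := by
    intro k
    induction k with
    | zero => intro x; rw [hθ0, hEC]
    | succ k ih =>
      intro x
      have h1 := hστ k x
      have h2 := hστ (k + 1) (x - h x)
      have h3 : σ (k + 2) (a (b x)) = σ (k + 2) (h (x - h x)) := by rw [hab, map_sub h]
      have h4 : τ (k + 2) (b (x - h x)) = σ (k + 1) (x - h x) - σ (k + 2) (h (x - h x)) := by
        rw [h2]; abel
      rw [hθ, map_sub, map_add, map_add, ih, hEA, hED, hED, h3, h4, h1, map_sub (σ (k + 1))]
      abel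
  have hEδ : ∀ k x, E (δ k x) = 0 := fun k x => by
    rw [hδ, map_sub, map_sub, hEθ, hEθ, hED, hστ k x]; abel
  have hES : ∀ k x, E (S k x) = 0 := by
    intro k
    induction k with
    | zero => intro x; rw [hS0, map_zero]
    | succ k ih => intro x; rw [hS, map_add, ih, hEδ, add_zero]
  have hEσ : ∀ k x, E (σ k x) = σ k x := fun k x => by
    rw [hσ, map_add, map_add, hEθ, hED, hES, add_zero, ← hστ, hσ]
  have hEτ : ∀ k v, E (τ k v) = τ k v := fun k v => by
    rw [hτ, map_add, hED, hES, add_zero, hτ]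
  refine ⟨E, ?_, fun x => ?_⟩
  · exact hext _ (fun x => by rw [Module.End.mul_apply, hEC, hEσ])
      (fun k v => by rw [Module.End.mul_apply, hED, hEτ])
      (fun k v => by rw [Module.End.mul_apply, hEA, hEσ])
  · rw [← hCx, hEC, hσ, hθ, hS0]
    simp [hD1, hA1, hθ1]

theorem nonempty_finsupp_nat_equiv_prod (R : Type*) [Ring R] :
    Nonempty ((ℕ →₀ R) ≃ₗ[R] (ℕ →₀ ℕ →₀ R) × (ℕ →₀ ℕ →₀ R)) := by
  obtain ⟨e⟩ := nonempty_equiv_of_countable (α := ℕ) (β := (ℕ × ℕ) ⊕ (ℕ × ℕ))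
  exact ⟨Finsupp.domLCongr e ≪≫ₗ Finsupp.sumFinsuppLEquivProdFinsupp R ≪≫ₗ
    (Finsupp.curryLinearEquiv R).prodCongr (Finsupp.curryLinearEquiv R)⟩

theorem exists_idempotent_corner_of_factor_finsupp (h : X →ₗ[R] X) (b : X →ₗ[R] (ℕ →₀ R))
    (a : (ℕ →₀ R) →ₗ[R] X) (hab : ∀ x, a (b x) = h x - h (h x)) :
    ∃ E : Module.End R ((ℕ →₀ R) × X), E * E = E ∧ ∀ x, (E (0, x)).2 = h x := by
  obtain ⟨E₀, hE₀, hcorner₀⟩ := exists_idempotent_corner_of_factor h b a hab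
  obtain ⟨ε⟩ := nonempty_finsupp_nat_equiv_prod R
  obtain ⟨φ, hφ⟩ : ∃ φ : ((ℕ →₀ R) × X) ≃ₗ[R] X × ((ℕ →₀ ℕ →₀ R) × (ℕ →₀ ℕ →₀ R)),
      ∀ y, φ y = (y.2, ε y.1) :=
    ⟨LinearEquiv.prodComm R _ _ ≪≫ₗ (LinearEquiv.refl R X).prodCongr ε, fun y => rfl⟩
  refine ⟨φ.symm.toLinearMap ∘ₗ E₀ ∘ₗ φ.toLinearMap, LinearMap.ext fun x => ?_, fun x => ?_⟩
  · have := LinearMap.congr_fun hE₀ (φ x)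
    rw [Module.End.mul_apply] at this
    simp only [Module.End.mul_apply, LinearMap.comp_apply, LinearEquiv.coe_coe,
      LinearEquiv.apply_symm_apply, this]
  · have h2 : ∀ y, (φ.symm y).2 = y.1 := fun y => by
      have := congrArg Prod.fst (hφ (φ.symm y))
      rw [LinearEquiv.apply_symm_apply] at this
      exact this.symm
    simp only [LinearMap.comp_apply, LinearEquiv.coe_coe]
    rw [h2, hφ, map_zero, hcorner₀]

theorem IsDirectSumOfFG.exists_isCompl {N : Type*} [AddCommGroup N] [Module R N]
    (hN : IsDirectSumOfFG R N) {C : Submodule R N} (hC : C.FG) :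
    ∃ P Q : Submodule R N, IsCompl P Q ∧ P.FG ∧ C ≤ P := by
  classical
  obtain ⟨ι, hι, B, hB, hfg⟩ := hN
  obtain ⟨hind, htop⟩ := (DirectSum.isInternal_submodule_iff_iSupIndep_and_iSup_eq_top B).1 hB
  obtain ⟨s, hs⟩ := CompleteLattice.IsCompactElement.exists_finset_of_le_iSup _
    ((Submodule.fg_iff_compact C).1 hC) B (htop ▸ le_top)
  set P : Submodule R N := ⨆ i ∈ s, B i with hP
  set Q : Submodule R N := ⨆ i ∈ {i | i ∉ s}, B i with hQ
  have hPQ : IsCompl P Q := by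
    constructor
    · exact hind.disjoint_biSup_biSup (s := {i | i ∈ s}) (t := {i | i ∉ s})
        (Set.disjoint_left.2 fun i hi hi' => hi' hi)
    · rw [codisjoint_iff, eq_top_iff, ← htop]
      refine iSup_le fun i => ?_
      by_cases hi : i ∈ s
      · exact le_sup_of_le_left (le_iSup₂_of_le i hi le_rfl)
      · exact le_sup_of_le_right (le_iSup₂_of_le i hi le_rfl)
  have hPfg : P.FG := Submodule.fg_biSup s B fun i _ => hfg i
  exact ⟨P, Q, hPQ, hPfg, hs⟩

/-- Let the retract `N` of `R^(ω) ⊕ X` be a direct sum of finitely generated modules. The idempotent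
endomorphism of `R^(ω) ⊕ X` given by `N` has the same `X`-corner as some idempotent endomorphism of
`X ⊕ Rⁿ`: in the decomposition of `N` only the finitely many components needed for the image of `X`
are kept. -/
theorem IsDirectSumOfFG.exists_idempotent_corner [Module.Finite R X] {N : Type*} [AddCommGroup N]
    [Module R N] (hN : IsDirectSumOfFG R N) (ι : N →ₗ[R] (ℕ →₀ R) × X)
    (ρ : (ℕ →₀ R) × X →ₗ[R] N) (hρι : ρ ∘ₗ ι = LinearMap.id) :
    ∃ (n : ℕ) (E : Module.End R (X × (Fin n → R))), E * E = E ∧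
      ∀ x, (E (x, 0)).1 = (ι (ρ (0, x))).2 := by
  have hρι' : ∀ y, ρ (ι y) = y := fun y => LinearMap.congr_fun hρι y
  obtain ⟨P, Q, hPQ, hPfg, hP⟩ := hN.exists_isCompl
    (C := LinearMap.range (ρ ∘ₗ LinearMap.inr R (ℕ →₀ R) X)) (Module.Finite.iff_fg.1 inferInstance)
  set G : Module.End R ((ℕ →₀ R) × X) := ι ∘ₗ P.subtype ∘ₗ P.projectionOnto Q hPQ ∘ₗ ρ with hG
  have hGapp : ∀ x, G x = ι (P.projectionOnto Q hPQ (ρ x)) := fun x => rfl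
  have hGid : ∀ y ∈ P, G (ι y) = ι y := fun y hy => by
    rw [hGapp, hρι', Submodule.projectionOnto_apply_of_mem_left hPQ hy]
  have hGX : ∀ x, G (0, x) = ι (ρ (0, x)) := fun x => by
    have hx : ρ (0, x) ∈ P := hP ⟨x, rfl⟩
    rw [hGapp, Submodule.projectionOnto_apply_of_mem_left hPQ hx]
  have hGG : ∀ x, G (G x) = G x := fun x => hGid _ (P.projectionOnto Q hPQ (ρ x)).2
  have hGfg : (LinearMap.range (LinearMap.fst R (ℕ →₀ R) X ∘ₗ G)).FG := by
    have h1 : LinearMap.range (LinearMap.fst R (ℕ →₀ R) X ∘ₗ G) =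
        P.map (LinearMap.fst R (ℕ →₀ R) X ∘ₗ ι) := by
      refine le_antisymm ?_ ?_
      · rintro _ ⟨x, rfl⟩
        exact ⟨_, (P.projectionOnto Q hPQ (ρ x)).2, rfl⟩
      · rintro _ ⟨y, hy, rfl⟩
        exact ⟨ι y, congrArg Prod.fst (hGid y hy)⟩
    rw [h1]
    exact hPfg.map _
  -- the range of `G` involves only finitely many coordinates of `R^(ω)`
  obtain ⟨n, i, p, hpi, hle⟩ := isLocallyPower_finsupp (R := R) (Z := R) ℕ _ hGfg
  have hip : ∀ x, i (p (G x).1) = (G x).1 := fun x => by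
    obtain ⟨y, hy⟩ := hle ⟨x, rfl⟩
    have hy' : i y = (G x).1 := hy
    rw [← hy']
    exact congrArg i (LinearMap.congr_fun hpi y)
  set j : X × (Fin n → R) →ₗ[R] (ℕ →₀ R) × X :=
    (i ∘ₗ LinearMap.snd R _ _).prod (LinearMap.fst R _ _) with hj
  set q : (ℕ →₀ R) × X →ₗ[R] X × (Fin n → R) :=
    (LinearMap.snd R _ _).prod (p ∘ₗ LinearMap.fst R _ _) with hq
  have hjq : ∀ x, j (q (G x)) = G x := fun x => Prod.ext (hip x) rfl
  refine ⟨n, q ∘ₗ G ∘ₗ j, LinearMap.ext fun x => ?_, fun x => ?_⟩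
  · simp only [Module.End.mul_apply, LinearMap.comp_apply, hjq, hGG]
  · have h1 : j (x, 0) = (0, x) := by simp [hj]
    change (G (j (x, 0))).2 = _
    rw [h1, hGX]

/-- Under the hypothesis on direct summands of `R^(ω) ⊕ X`, an endomorphism of `X` that is
idempotent modulo endomorphisms factoring through a free module of countable rank is the `X`-corner
of an idempotent endomorphism of some `X ⊕ Rⁿ`. -/
theorem SummandsAreDirectSumsOfFG.exists_idempotent_corner [Module.Finite R X]
    (hX : SummandsAreDirectSumsOfFG R ((ℕ →₀ R) × X)) (h : X →ₗ[R] X) (b : X →ₗ[R] (ℕ →₀ R))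
    (a : (ℕ →₀ R) →ₗ[R] X) (hab : ∀ x, a (b x) = h x - h (h x)) :
    ∃ (n : ℕ) (E : Module.End R (X × (Fin n → R))), E * E = E ∧ ∀ x, (E (x, 0)).1 = h x := by
  obtain ⟨E, hE, hcorner⟩ := exists_idempotent_corner_of_factor_finsupp h b a hab
  have hN := hX _ _ (LinearMap.IsIdempotentElem.isCompl hE)
  obtain ⟨n, E', hE', hcorner'⟩ := hN.exists_idempotent_corner (LinearMap.range E).subtype
    E.rangeRestrict (by
      refine LinearMap.ext fun x => Subtype.ext ?_
      obtain ⟨_, y, rfl⟩ := x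
      exact LinearMap.congr_fun hE y)
  exact ⟨n, E', hE', fun x => (hcorner' x).trans (hcorner x)⟩

end Corner

/-! ### Modules over a local ring -/

section Local

open IsLocalRing

variable {A : Type*} [CommRing A] [IsLocalRing A] {Y W : Type*} [AddCommGroup Y] [Module A Y]
  [AddCommGroup W] [Module A W]

omit [IsLocalRing A] in
/-- If the `A`-corner of an idempotent endomorphism of `W × A` is a unit, then the Schur complement
is an idempotent endomorphism of `W`. -/
theorem exists_idempotent_schur_of_isUnit {E : Module.End A (W × A)} (hE : E * E = E)
    (hu : IsUnit (E (0, 1)).2) :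
    ∃ e : Module.End A W, e * e = e ∧
      ∃ (α : W →ₗ[A] A) (w : W), ∀ x, e x = (E (x, 0)).1 + α x • w := by
  obtain ⟨u, hu⟩ := hu.exists_right_inv
  set a : W →ₗ[A] W := LinearMap.fst A W A ∘ₗ E ∘ₗ LinearMap.inl A W A with ha
  set c : W →ₗ[A] A := LinearMap.snd A W A ∘ₗ E ∘ₗ LinearMap.inl A W A with hc
  set b : W := (E (0, 1)).1 with hb
  set ρ : A := (E (0, 1)).2 with hρ
  have hEapp : ∀ x t, E (x, t) = (a x + t • b, c x + t * ρ) := fun x t => by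
    have h1 : ((x, t) : W × A) = (x, 0) + t • (0, 1) := by simp
    rw [h1, map_add, map_smul]
    rfl
  have hEE : ∀ x t, E (E (x, t)) = E (x, t) := fun x t => LinearMap.congr_fun hE (x, t)
  have h1 : ∀ x, a (a x) = a x - c x • b := fun x => by
    have := congrArg Prod.fst (hEE x 0)
    simp only [hEapp, zero_smul, add_zero, zero_mul] at this
    exact eq_sub_of_add_eq this
  have h2 : ∀ x, c (a x) = c x - c x * ρ := fun x => by
    have := congrArg Prod.snd (hEE x 0)
    simp only [hEapp, zero_smul, add_zero, zero_mul] at this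
    rw [eq_sub_iff_add_eq, this]
  have h3 : a b = b - ρ • b := by
    have := congrArg Prod.fst (hEE 0 1)
    simp only [hEapp, map_zero, zero_add, one_smul, one_mul] at this
    rw [eq_sub_iff_add_eq, this]
  have h4 : c b = ρ - ρ * ρ := by
    have := congrArg Prod.snd (hEE 0 1)
    simp only [hEapp, map_zero, zero_add, one_smul, one_mul] at this
    rw [eq_sub_iff_add_eq, this]
  refine ⟨a + (-u • c).smulRight b, LinearMap.ext fun x => ?_, -u • c, b, fun x => rfl⟩
  have he : ∀ x, (a + (-u • c).smulRight b) x = a x - (u * c x) • b := fun x => by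
    simp [sub_eq_add_neg]
  simp only [Module.End.mul_apply, he, map_sub, map_smul, h1, h2, h3, h4, smul_eq_mul]
  have key : u * (c x - c x * ρ - u * c x * (ρ - ρ * ρ)) = u * c x * ρ - c x := by
    linear_combination (c x * u * ρ - c x * u - c x ) * hu
  rw [key]
  module

/-- Splitting off one copy of the local ring `A`: the `W`-corner of an idempotent endomorphism of
`W × A` is congruent to an idempotent endomorphism of `W` modulo maps factoring through `A`. -/
theorem exists_idempotent_schur_step {E : Module.End A (W × A)} (hE : E * E = E) :
    ∃ e : Module.End A W, e * e = e ∧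
      ∃ (α : W →ₗ[A] A) (w : W), ∀ x, e x = (E (x, 0)).1 + α x • w := by
  rcases isUnit_or_isUnit_one_sub_self (E (0, 1)).2 with h | h
  · exact exists_idempotent_schur_of_isUnit hE h
  · obtain ⟨e, he, α, w, hα⟩ := exists_idempotent_schur_of_isUnit (E := 1 - E)
      (by rw [mul_sub, sub_mul, sub_mul, hE]; simp) (by simpa using h)
    refine ⟨1 - e, by rw [mul_sub, sub_mul, sub_mul, he]; simp, -α, w, fun x => ?_⟩
    simp only [LinearMap.sub_apply, Module.End.one_apply, hα, LinearMap.neg_apply, Prod.fst_sub]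
    module

/-- Let `Y` have no direct summand isomorphic to the local ring `A`. Then the `Y`-corner of an
idempotent endomorphism of `Y × Aⁿ` is congruent to an idempotent endomorphism of `Y` modulo the
maximal ideal. -/
theorem exists_idempotent_congr_corner (hY : ∀ (α : Y →ₗ[A] A) y, α y ∈ maximalIdeal A) (n : ℕ)
    {E : Module.End A (Y × (Fin n → A))} (hE : E * E = E) :
    ∃ e : Module.End A Y, e * e = e ∧
      ∀ y, e y - (E (y, 0)).1 ∈ maximalIdeal A • (⊤ : Submodule A Y) := by
  induction n with
  | zero =>
    refine ⟨LinearMap.fst A _ _ ∘ₗ E ∘ₗ LinearMap.inl A _ _, LinearMap.ext fun y => ?_,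
      fun y => by simp⟩
    have h1 : ∀ x : Y × (Fin 0 → A), (x.1, 0) = x := fun x => Prod.ext rfl (Subsingleton.elim _ _)
    have := congrArg Prod.fst (LinearMap.congr_fun hE (y, 0))
    change (E ((E (y, 0)).1, 0)).1 = (E (y, 0)).1
    rw [h1]
    exact this
  | succ n ih =>
    obtain ⟨Φ, hΦ, hΦ'⟩ : ∃ Φ : (Y × (Fin (n + 1) → A)) ≃ₗ[A] (Y × (Fin n → A)) × A,
        (∀ x, (Φ x).1.1 = x.1) ∧ ∀ y, Φ (y, 0) = ((y, 0), 0) :=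
      ⟨{ toFun := fun x => ((x.1, Fin.tail x.2), x.2 0)
         map_add' := fun x y => rfl
         map_smul' := fun c x => rfl
         invFun := fun x => (x.1.1, Fin.cons x.2 x.1.2)
         left_inv := fun x => by simp
         right_inv := fun x => by simp }, fun x => rfl, fun y => rfl⟩
    have hE' : ∀ x, E (E x) = E x := LinearMap.congr_fun hE
    obtain ⟨e₁, he₁, α, w, hα⟩ := exists_idempotent_schur_step
      (E := Φ.toLinearMap ∘ₗ E ∘ₗ Φ.symm.toLinearMap) (LinearMap.ext fun x => by simp [hE'])
    obtain ⟨e, he, h⟩ := ih he₁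
    refine ⟨e, he, fun y => ?_⟩
    have h1 : Φ.symm ((y, 0), 0) = (y, 0) := by rw [LinearEquiv.symm_apply_eq, hΦ']
    have h2 : (e₁ (y, 0)).1 = (E (y, 0)).1 + α (y, 0) • w.1 := by
      rw [hα]
      simp [hΦ, h1]
    have h3 : α (y, 0) ∈ maximalIdeal A := hY (α ∘ₗ LinearMap.inl A _ _) y
    have h4 : e y - (E (y, 0)).1 = (e y - (e₁ (y, 0)).1) + α (y, 0) • w.1 := by rw [h2]; abel
    rw [h4]
    exact Submodule.add_mem _ (h y) (Submodule.smul_mem_smul h3 Submodule.mem_top)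

theorem isUnit_end_of_sub_mem_maximalIdeal_smul [Module.Finite A Y] (u : Module.End A Y)
    (hu : ∀ y, u y - y ∈ maximalIdeal A • (⊤ : Submodule A Y)) : IsUnit u := by
  have hsurj : Function.Surjective u := by
    rw [← LinearMap.range_eq_top, eq_top_iff]
    refine Submodule.le_of_le_smul_of_le_jacobson_bot (I := maximalIdeal A)
      Module.Finite.fg_top (maximalIdeal_le_jacobson _) fun y _ => ?_
    rw [← sub_sub_cancel (u y) y]
    exact Submodule.sub_mem _ (Submodule.mem_sup_left ⟨y, rfl⟩) (Submodule.mem_sup_right (hu y))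
  exact (Module.End.isUnit_iff u).2
    ⟨OrzechProperty.injective_of_surjective_endomorphism u hsurj, hsurj⟩

/-- The exchange condition for an endomorphism `φ` of a finitely generated module over a local ring
only needs to be checked up to the maximal ideal: modulo it, `e a φ + (1 - e) b (1 - φ)` is the
identity, so this combination is a unit by Nakayama's lemma. -/
theorem exists_idempotent_of_congr [Module.Finite A Y] {φ a b e : Module.End A Y} (he : e * e = e)
    (hea : ∀ y, e y - a (φ y) ∈ maximalIdeal A • (⊤ : Submodule A Y))
    (ha : ∀ y, a (φ y) - a (φ (a (φ y))) ∈ maximalIdeal A • (⊤ : Submodule A Y))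
    (hb : ∀ y, a (φ y) + b (y - φ y) - y ∈ maximalIdeal A • (⊤ : Submodule A Y)) :
    ∃ e t t' : Module.End A Y, IsIdempotentElem e ∧ e = t * φ ∧ 1 - e = t' * (1 - φ) := by
  refine exists_idempotent_of_isUnit (e := e) (a := a) (b := b) he
    (isUnit_end_of_sub_mem_maximalIdeal_smul _ fun y => ?_)
  set J := maximalIdeal A • (⊤ : Submodule A Y) with hJ
  have hstab : ∀ (f : Module.End A Y), ∀ y ∈ J, f y ∈ J := fun f y hy => by
    have : J.map f ≤ J := by
      rw [hJ, Submodule.map_smul'']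
      exact Submodule.smul_mono le_rfl le_top
    exact this ⟨y, hy, rfl⟩
  have h1 := hstab (1 - e) _ (hb y)
  have h2 := hea (a (φ y))
  have h3 := ha y
  have h4 := hea y
  have h5 : (e * a * φ + (1 - e) * b * (1 - φ)) y - y =
      (1 - e) (a (φ y) + b (y - φ y) - y) + (e (a (φ y)) - a (φ (a (φ y))))
        + (e (a (φ y)) - a (φ (a (φ y)))) - (a (φ y) - a (φ (a (φ y))))
        + (-(e y - a (φ y))) + (- (a (φ y) - a (φ (a (φ y))))) := by
    simp only [LinearMap.add_apply, Module.End.mul_apply, LinearMap.sub_apply, Module.End.one_apply,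
      map_sub, map_add]
    abel
  rw [h5]
  exact J.add_mem (J.add_mem (J.sub_mem (J.add_mem (J.add_mem h1 h2) h2) h3) (J.neg_mem h4))
    (J.neg_mem h3)

/-- The exchange condition for a strongly π-regular element of a commutative ring. -/
theorem exists_idempotent_of_isNilpotent {B : Type*} [CommRing B] {x y : B} {j : ℕ}
    (h : IsNilpotent (x ^ j * (1 - x * y))) :
    ∃ a b : B, a * x * (a * x) = a * x ∧ a * x + b * (1 - x) = 1 := by
  obtain ⟨N, hN⟩ := h
  obtain ⟨z, hz⟩ : x ∣ 1 - (1 - x * y) ^ N := by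
    have := sub_dvd_pow_sub_pow (1 : B) (1 - x * y) N
    rw [one_pow, sub_sub_cancel] at this
    exact (Dvd.intro _ rfl).trans this
  set n := j * N + 1 with hn
  have h1 : x ^ n = x ^ n * (x * z) := by
    have : x ^ n * (1 - x * y) ^ N = 0 := by
      rw [hn, pow_succ, pow_mul, mul_right_comm, ← mul_pow, hN, zero_mul]
    rw [← hz, mul_sub, this, mul_one, sub_zero]
  have h2 : ∀ k, x ^ n = x ^ n * (x * z) ^ k := by
    intro k
    induction k with
    | zero => simp
    | succ k ih => rw [pow_succ (x * z), ← mul_assoc, ← ih, ← h1]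
  set e := (x * z) ^ n with he
  have h3 : x ^ n * e = x ^ n := (h2 n).symm
  have hee : e * e = e := by
    calc e * e = (x ^ n * e) * z ^ n := by rw [he]; ring
      _ = e := by rw [h3, he, mul_pow]
  have hw : IsNilpotent ((1 - e) * x) :=
    ⟨n, by
      have : (1 - e) ^ n = 1 - e := by
        rw [hn, IsIdempotentElem.pow_succ_eq _ (IsIdempotentElem.one_sub hee)]
      rw [mul_pow, this, sub_mul, one_mul, mul_comm, h3, sub_self]⟩
  obtain ⟨v, hv⟩ := hw.isUnit_one_sub.exists_right_inv
  refine ⟨x ^ (j * N) * z ^ n, (1 - e) * v, ?_, ?_⟩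
  · have : x ^ (j * N) * z ^ n * x = e := by rw [he, hn]; ring
    rw [this, hee]
  · have : x ^ (j * N) * z ^ n * x = e := by rw [he, hn]; ring
    rw [this]
    linear_combination (1 - e) * hv + v * x * hee

/-- If every element of the maximal ideal has a power divisible by `r`, then every endomorphism `φ`
of a finitely generated module satisfies the exchange condition modulo `r`. By Cayley–Hamilton, `φ`
is a root of a monic polynomial `p`. Writing `p = X ^ j * q + l` with `q(0)` a unit and `l` of
degree less than `j` with coefficients in the maximal ideal shows that the class of `X` in
`A[X] / (p, r)` is strongly π-regular. -/
theorem exists_exchange_mod {r : A} (hr : ∀ x ∈ maximalIdeal A, ∃ n, r ∣ x ^ n)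
    [Module.Finite A Y] (φ : Module.End A Y) :
    ∃ a b ψ ψ' : Module.End A Y, a * φ - a * φ * (a * φ) = r • ψ ∧
      a * φ + b * (1 - φ) - 1 = r • ψ' := by
  classical
  obtain ⟨p, hp, hpφ⟩ := LinearMap.exists_monic_and_aeval_eq_zero A φ
  have hex : ∃ j, IsUnit (p.coeff j) := ⟨p.natDegree, by rw [hp.coeff_natDegree]; exact isUnit_one⟩
  obtain ⟨j, hj, hmin⟩ : ∃ j, IsUnit (p.coeff j) ∧ ∀ i < j, p.coeff i ∈ maximalIdeal A :=
    ⟨Nat.find hex, Nat.find_spec hex, fun i hi =>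
      (mem_maximalIdeal _).2 (Nat.find_min hex hi)⟩
  set l : Polynomial A := ∑ i ∈ Finset.range j, Polynomial.C (p.coeff i) * Polynomial.X ^ i with hl
  obtain ⟨q, hq⟩ : Polynomial.X ^ j ∣ p - l := by
    rw [Polynomial.X_pow_dvd_iff]
    intro d hd
    rw [Polynomial.coeff_sub, hl, Polynomial.finsetSum_coeff]
    simp [Polynomial.coeff_C_mul, Polynomial.coeff_X_pow, hd]
  have hq0 : q.coeff 0 = p.coeff j := by
    have h1 := congrArg (fun f => Polynomial.coeff f j) hq
    have h2 : l.coeff j = 0 := by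
      rw [hl, Polynomial.finsetSum_coeff]
      refine Finset.sum_eq_zero fun i hi => ?_
      simp [Polynomial.coeff_X_pow, (Finset.mem_range.1 hi).ne']
    simpa [Polynomial.coeff_X_pow_mul', h2] using h1.symm
  obtain ⟨c, hc⟩ := hj.exists_right_inv
  set I : Ideal (Polynomial A) := Ideal.span {p, Polynomial.C r} with hI
  set π := Ideal.Quotient.mk I with hπ
  have hπp : π p = 0 := Ideal.Quotient.eq_zero_iff_mem.2 (Ideal.subset_span (by simp))
  have hπr : π (Polynomial.C r) = 0 :=
    Ideal.Quotient.eq_zero_iff_mem.2 (Ideal.subset_span (by simp))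
  have hπl : IsNilpotent (π l) := by
    rw [hl, map_sum]
    refine isNilpotent_sum fun i hi => ?_
    rw [map_mul]
    refine Commute.isNilpotent_mul_right (Commute.all _ _) ?_
    obtain ⟨n, s, hs⟩ := hr _ (hmin i (Finset.mem_range.1 hi))
    exact ⟨n, by rw [← map_pow, ← map_pow, hs, map_mul, map_mul, hπr, zero_mul]⟩
  have hnil : IsNilpotent (π Polynomial.X ^ j *
      (1 - π Polynomial.X * π (-(Polynomial.C c * q.divX)))) := by
    have h1 : Polynomial.X ^ j * (1 - Polynomial.X * (-(Polynomial.C c * q.divX))) =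
        Polynomial.C c * (p - l) := by
      have h2 : Polynomial.C c * Polynomial.C (q.coeff 0) = 1 := by
        rw [hq0, ← Polynomial.C_mul, mul_comm, hc, Polynomial.C_1]
      rw [hq]
      conv_rhs => rw [← Polynomial.divX_mul_X_add q]
      linear_combination -(Polynomial.X ^ j) * h2
    have h3 := congrArg π h1
    simp only [map_mul, map_sub, map_pow, map_one, hπp, zero_sub] at h3
    rw [h3]
    exact Commute.isNilpotent_mul_left (Commute.all _ _) hπl.neg
  obtain ⟨a, b, h1, h2⟩ := exists_idempotent_of_isNilpotent hnil
  obtain ⟨a, rfl⟩ := Ideal.Quotient.mk_surjective a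
  obtain ⟨b, rfl⟩ := Ideal.Quotient.mk_surjective b
  have key : ∀ f : Polynomial A, π f = 0 → ∃ ψ, Polynomial.aeval φ f = r • ψ := by
    intro f hf
    rw [hπ, Ideal.Quotient.eq_zero_iff_mem, hI, Ideal.mem_span_pair] at hf
    obtain ⟨s, t, rfl⟩ := hf
    refine ⟨Polynomial.aeval φ t, ?_⟩
    rw [map_add, map_mul, map_mul, hpφ, mul_zero, zero_add, Polynomial.aeval_C,
      ← Algebra.commutes, ← Algebra.smul_def]
  obtain ⟨ψ, hψ⟩ := key (a * Polynomial.X - a * Polynomial.X * (a * Polynomial.X)) (by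
    simp only [map_sub, map_mul]
    rw [h1, sub_self])
  obtain ⟨ψ', hψ'⟩ := key (a * Polynomial.X + b * (1 - Polynomial.X) - 1) (by
    simp only [map_sub, map_mul, map_add, map_one]
    rw [h2, sub_self])
  refine ⟨Polynomial.aeval φ a, Polynomial.aeval φ b, ψ, ψ', ?_, ?_⟩
  · rw [← hψ]; simp
  · rw [← hψ']; simp

/-- A finitely generated module over a local ring is the direct sum of a free module and a module
without direct summands isomorphic to the ring. -/
theorem exists_equiv_prod_free (W : Type v) [AddCommGroup W] [Module A W] [Module.Finite A W] :
    ∃ (Y : Type v) (_ : AddCommGroup Y) (_ : Module A Y) (n : ℕ) (_ : W ≃ₗ[A] Y × (Fin n → A)),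
      ∀ (α : Y →ₗ[A] A) y, α y ∈ maximalIdeal A := by
  classical
  obtain ⟨k, f, hf⟩ := Module.Finite.exists_fin' A W
  set P : ℕ → Prop := fun n => ∃ s : W →ₗ[A] (Fin n → A), Function.Surjective s with hP
  have hbound : ∀ n, P n → n ≤ k := fun n ⟨s, hs⟩ =>
    le_of_fin_surjective A (s ∘ₗ f) (hs.comp hf)
  have hP0 : P 0 := ⟨0, fun x => ⟨0, Subsingleton.elim _ _⟩⟩
  set n := Nat.findGreatest P k with hn
  have hPn : P n := Nat.findGreatest_spec (Nat.zero_le k) hP0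
  have hPn1 : ¬ P (n + 1) := fun h => by
    have := Nat.le_findGreatest (hbound _ h) h
    omega
  obtain ⟨s, hs⟩ := hPn
  obtain ⟨g, hg⟩ := Module.projective_lifting_property s LinearMap.id hs
  have hg' : ∀ v, s (g v) = v := fun v => LinearMap.congr_fun hg v
  let e : W ≃ₗ[A] LinearMap.ker s × (Fin n → A) :=
    { toFun := fun x => (⟨x - g (s x), by simp [hg']⟩, s x)
      map_add' := fun x y => by ext <;> simp; abel
      map_smul' := fun c x => by ext <;> simp [smul_sub]
      invFun := fun x => x.1 + g x.2
      left_inv := fun x => by simp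
      right_inv := fun x => by
        have : s x.1 = 0 := x.1.2
        ext <;> simp [hg', this] }
  refine ⟨LinearMap.ker s, inferInstance, inferInstance, n, e, fun α y => ?_⟩
  by_contra hα
  rw [mem_maximalIdeal, mem_nonunits_iff, not_not] at hα
  obtain ⟨u, hu⟩ := hα.exists_right_inv
  have hαs : Function.Surjective α := fun t => ⟨(t * u) • y, by
    rw [map_smul, smul_eq_mul, mul_assoc, mul_comm u, hu, mul_one]⟩
  exact hPn1 ⟨(Fin.consLinearEquiv A fun _ => A).toLinearMap ∘ₗ
    (α.prodMap LinearMap.id) ∘ₗ e.toLinearMap, (Fin.consLinearEquiv A fun _ => A).surjective.comp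
      ((hαs.prodMap Function.surjective_id).comp e.surjective)⟩

end Local

/-! ### Passing between a domain and its localizations -/

section Global

variable {R : Type*} [CommRing R]

/-- On a finitely generated module over a domain, multiplication by some non-zero multiple `r` of a
given non-zero element factors through a free module, namely the span of a maximal linearly
independent set of generators. -/
theorem exists_smul_factors_through_free [IsDomain R] (X : Type*) [AddCommGroup X] [Module R X]
    [Module.Finite R X] {r₀ : R} (hr₀ : r₀ ≠ 0) :
    ∃ r : R, r ≠ 0 ∧ r₀ ∣ r ∧ ∃ (b : X →ₗ[R] (ℕ →₀ R)) (a : (ℕ →₀ R) →ₗ[R] X),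
      ∀ x, a (b x) = r • x := by
  classical
  obtain ⟨n, v, hv⟩ := Module.Finite.exists_fin (R := R) (M := X)
  obtain ⟨s, hs, hmax⟩ := exists_maximal_linearIndepOn R v
  have hex : ∀ i, ∃ c : R, c ≠ 0 ∧ c • v i ∈ Submodule.span R (v '' s) := fun i => by
    by_cases hi : i ∈ s
    · exact ⟨1, one_ne_zero, Submodule.smul_mem _ _ (Submodule.subset_span ⟨i, hi, rfl⟩)⟩
    · exact hmax i hi
  choose c hc hcv using hex
  set r := r₀ * ∏ i, c i with hr
  have hrange : Set.range (fun i : s => v i) = v '' s := by ext; simp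
  have hmem : ∀ x : X, r • x ∈ Submodule.span R (Set.range fun i : s => v i) := by
    intro x
    rw [hrange]
    have : (⊤ : Submodule R X) ≤ (Submodule.span R (v '' s)).comap (LinearMap.lsmul R X r) := by
      rw [← hv, Submodule.span_le]
      rintro _ ⟨i, rfl⟩
      change r • v i ∈ Submodule.span R (v '' s)
      rw [hr, ← Finset.prod_erase_mul _ _ (Finset.mem_univ i), ← mul_assoc, mul_smul]
      exact Submodule.smul_mem _ _ (hcv i)
    exact this Submodule.mem_top
  have hs' : LinearIndependent R fun i : s => v i := hs
  set g : s → ℕ := fun i => (i : Fin n) with hg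
  have hginj : Function.Injective g := Fin.val_injective.comp Subtype.val_injective
  refine ⟨r, mul_ne_zero hr₀ (Finset.prod_ne_zero_iff.2 fun i _ => hc i), Dvd.intro _ rfl,
    Finsupp.lmapDomain R R g ∘ₗ hs'.repr ∘ₗ
      (LinearMap.lsmul R X r).codRestrict _ hmem,
    Finsupp.linearCombination R (fun i : s => v i) ∘ₗ Finsupp.lcomapDomain g hginj, fun x => ?_⟩
  simp only [LinearMap.comp_apply, Finsupp.lmapDomain_apply,
    Finsupp.leftInverse_lcomapDomain_mapDomain g hginj _]
  exact hs'.linearCombination_repr _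

/-- Let `r` be a non-zero element of a domain of dimension at most one that lies in only finitely
many maximal ideals. Then `R / r` is zero-dimensional with finite, hence discrete, spectrum, so some
`t` outside the maximal ideal `m` is idempotent modulo `r` and divisible modulo `r` by every element
outside `m`. -/
theorem exists_idempotent_mod [IsDomain R] [Ring.KrullDimLE 1 R] (m : Ideal R) [m.IsMaximal] {r : R}
    (hr : r ≠ 0) (hrm : r ∈ m) (hfin : {m : Ideal R | m.IsMaximal ∧ r ∈ m}.Finite) :
    ∃ t ∉ m, (∃ d, t * t - t = r * d) ∧ ∀ s ∉ m, ∃ s' c, t - s * s' = r * c := by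
  set I : Ideal R := Ideal.span {r} with hI
  set π := Ideal.Quotient.mk I with hπ
  have hrI : r ∈ I := Ideal.mem_span_singleton_self r
  have hcomap : ∀ P : Ideal (R ⧸ I), P.IsPrime → (P.comap π).IsMaximal ∧ r ∈ P.comap π := by
    intro P hP
    have h1 : r ∈ P.comap π := by
      rw [Ideal.mem_comap, hπ, Ideal.Quotient.eq_zero_iff_mem.2 hrI]
      exact P.zero_mem
    exact ⟨(Ideal.IsPrime.comap π).isMaximal_of_ne_bot fun h => hr (by rwa [h] at h1), h1⟩
  have hdim : Ring.KrullDimLE 0 (R ⧸ I) := .mk₀ fun P hP => by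
    have h1 := (hcomap P hP).1
    have h2 : (P.comap π).map π = P := Ideal.map_comap_of_surjective π
      Ideal.Quotient.mk_surjective P
    rw [← h2]
    refine (Ideal.map_eq_top_or_isMaximal_of_surjective π Ideal.Quotient.mk_surjective
      h1).resolve_left ?_
    rw [h2]
    exact hP.ne_top
  have hfinite : Finite (PrimeSpectrum (R ⧸ I)) := by
    have := hfin.to_subtype
    refine Finite.of_injective (β := {m : Ideal R | m.IsMaximal ∧ r ∈ m})
      (fun P => ⟨P.asIdeal.comap π, hcomap _ P.isPrime⟩) fun P Q h => ?_
    exact PrimeSpectrum.ext (Ideal.comap_injective_of_surjective π Ideal.Quotient.mk_surjective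
      (congrArg Subtype.val h))
  have hdisc : DiscreteTopology (PrimeSpectrum (R ⧸ I)) :=
    PrimeSpectrum.discreteTopology_iff_finite_and_krullDimLE_zero.2 ⟨hfinite, hdim⟩
  have hker : RingHom.ker π ≤ m := by
    rw [hπ, Ideal.mk_ker, hI, Ideal.span_singleton_le_iff_mem]
    exact hrm
  have hmprime : (m.map π).IsPrime :=
    Ideal.map_isPrime_of_surjective Ideal.Quotient.mk_surjective hker
  have hmcomap : (m.map π).comap π = m := by
    rw [Ideal.comap_map_of_surjective π Ideal.Quotient.mk_surjective, sup_eq_left]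
    exact hker
  set p : PrimeSpectrum (R ⧸ I) := ⟨m.map π, hmprime⟩ with hp
  obtain ⟨e, he, hpe⟩ := PrimeSpectrum.exists_idempotent_basicOpen_eq_of_isClopen
    (isClopen_discrete {p})
  obtain ⟨t, rfl⟩ := Ideal.Quotient.mk_surjective e
  have hdvd : ∀ x, π x = 0 → ∃ d, x = r * d := fun x hx => by
    rw [hπ, Ideal.Quotient.eq_zero_iff_mem, hI, Ideal.mem_span_singleton] at hx
    exact hx
  refine ⟨t, ?_, hdvd _ (by rw [map_sub, map_mul, he.eq, sub_self]), fun s hs => ?_⟩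
  · intro ht
    have h1 : p ∈ (PrimeSpectrum.basicOpen (π t) : Set (PrimeSpectrum (R ⧸ I))) :=
      hpe ▸ Set.mem_singleton p
    exact h1 (Ideal.mem_map_of_mem π ht)
  · -- no prime of `R / r` contains both `s` and `1 - t`
    have htop : Ideal.span {π s, 1 - π t} = ⊤ := by
      by_contra hne
      obtain ⟨M, hM, hle⟩ := Ideal.exists_le_maximal _ hne
      have h1 : π s ∈ M := hle (Ideal.subset_span (by simp))
      have h2 : 1 - π t ∈ M := hle (Ideal.subset_span (by simp))
      have h3 : (⟨M, hM.isPrime⟩ : PrimeSpectrum (R ⧸ I)) ∈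
          (PrimeSpectrum.basicOpen (π t) : Set (PrimeSpectrum (R ⧸ I))) := fun h =>
        hM.ne_top ((Ideal.eq_top_iff_one _).2 (by
          rw [← sub_add_cancel 1 (π t)]
          exact M.add_mem h2 h))
      rw [← hpe, Set.mem_singleton_iff] at h3
      have h4 : M = m.map π := congrArg PrimeSpectrum.asIdeal h3
      refine hs ?_
      rw [← hmcomap, Ideal.mem_comap, ← h4]
      exact h1
    obtain ⟨x, y, hxy⟩ := Ideal.mem_span_pair.1 (htop ▸ Submodule.mem_top : (1 : R ⧸ I) ∈ _)
    obtain ⟨x, rfl⟩ := Ideal.Quotient.mk_surjective x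
    obtain ⟨c, hc⟩ := hdvd (t - s * (x * t)) (by
      simp only [map_sub, map_mul]
      have he' : π t * π t = π t := he.eq
      linear_combination -π t * hxy - y * he')
    exact ⟨x * t, c, hc⟩

section Descent

variable (S : Submonoid R) {A : Type*} [CommRing A] [Algebra R A] [IsLocalization S A]
  {X X' : Type*} [AddCommGroup X] [Module R X] [Module.Finite R X] [AddCommGroup X'] [Module R X']
  [Module A X'] [IsScalarTower R A X'] (f : X →ₗ[R] X') [IsLocalizedModule S f]

include S in
omit [IsLocalization S A] in
/-- Up to a denominator, an endomorphism of a localization comes from the finitely generated module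
that is localized, provided that module embeds in its localization. -/
theorem exists_comp_eq_smul (hf : Function.Injective f) (g : Module.End A X') :
    ∃ s ∈ S, ∃ ψ : X →ₗ[R] X, ∀ x, f (ψ x) = s • g (f x) := by
  obtain ⟨n, v, hv⟩ := Module.Finite.exists_fin (R := R) (M := X)
  obtain ⟨s, hs⟩ := IsLocalizedModule.exist_integer_multiples_of_finite S f fun i => g (f (v i))
  have hmem : ∀ x, s.1 • g (f x) ∈ LinearMap.range f := by
    intro x
    have : (⊤ : Submodule R X) ≤
        (LinearMap.range f).comap (s.1 • (g.restrictScalars R ∘ₗ f)) := by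
      rw [← hv, Submodule.span_le]
      rintro _ ⟨i, rfl⟩
      exact hs i
    exact this (Submodule.mem_top (x := x))
  refine ⟨s, s.2, (LinearEquiv.ofInjective f hf).symm.toLinearMap ∘ₗ
    (s.1 • (g.restrictScalars R ∘ₗ f)).codRestrict _ hmem, fun x => ?_⟩
  exact congrArg Subtype.val ((LinearEquiv.ofInjective f hf).apply_symm_apply _)

include S in
omit [IsLocalization S A] in
/-- Divisibility by `r` of an endomorphism over the localization descends up to a denominator. -/
theorem exists_smul_eq_smul (hf : Function.Injective f) {r : R} (ψ : X →ₗ[R] X)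
    (χ : Module.End A X') (h : ∀ x, f (ψ x) = r • χ (f x)) :
    ∃ s ∈ S, ∃ ψ' : X →ₗ[R] X, ∀ x, s • ψ x = r • ψ' x := by
  obtain ⟨s, hs, ψ', hψ'⟩ := exists_comp_eq_smul S f hf χ
  refine ⟨s, hs, ψ', fun x => hf ?_⟩
  rw [map_smul, map_smul, hψ', h, smul_comm]

end Descent

/-- Let `R` be a domain of dimension at most one and `r` a non-zero element lying in only finitely
many maximal ideals, one of which is `m`. An endomorphism of `X_m` that is idempotent modulo `r` is
congruent modulo `r` to an endomorphism of `X` that is idempotent modulo `r`. This is where the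
decomposition of `R / r` into local factors enters. -/
theorem exists_end_congr_localization [IsDomain R] [Ring.KrullDimLE 1 R] (m : Ideal R)
    [m.IsMaximal] {r : R} (hr : r ≠ 0) (hrm : r ∈ m)
    (hfin : {m : Ideal R | m.IsMaximal ∧ r ∈ m}.Finite)
    {A : Type*} [CommRing A] [Algebra R A] [IsLocalization.AtPrime A m]
    {X X' : Type*} [AddCommGroup X] [Module R X] [Module.Finite R X] [AddCommGroup X'] [Module R X']
    [Module A X'] [IsScalarTower R A X'] (f : X →ₗ[R] X') [IsLocalizedModule m.primeCompl f]
    (hf : Function.Injective f) {g χ : Module.End A X'} (hg : ∀ x, g x - g (g x) = r • χ x) :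
    ∃ h κ : X →ₗ[R] X, (∀ x, h x - h (h x) = r • κ x) ∧
      ∃ ξ : Module.End A X', ∀ x, f (h x) = g (f x) + r • ξ (f x) := by
  obtain ⟨t, htm, ⟨d, hd⟩, ht⟩ := exists_idempotent_mod m hr hrm hfin
  obtain ⟨s, hs, ψ, hψ⟩ := exists_comp_eq_smul m.primeCompl f hf g
  obtain ⟨s', c, hc⟩ := ht s hs
  have htu : IsUnit (algebraMap R A t) := IsLocalization.map_units A (⟨t, htm⟩ : m.primeCompl)
  obtain ⟨u, hu⟩ := htu.exists_left_inv
  -- `t² ≡ 1` modulo `r` over the localization, as `t` is a unit there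
  have ht2 : algebraMap R A (t * t) =
      1 + algebraMap R A r * (u * algebraMap R A (d * (t + 1))) := by
    have h1 : algebraMap R A (t * t - t) = algebraMap R A (r * d) := by rw [hd]
    simp only [map_mul, map_sub, map_add, map_one] at h1 ⊢
    linear_combination u * (algebraMap R A t + 1) * h1 -
      (algebraMap R A t + 1) * (algebraMap R A t - 1) * hu
  -- `ψ` localizes to `s g`, and `t s' s` is `t²` modulo `r`
  set h : X →ₗ[R] X := (t * s') • ψ with hh
  set ξ : Module.End A X' := (u * algebraMap R A (d * (t + 1)) - algebraMap R A (t * c)) • g with hξ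
  have hfh : ∀ x, f (h x) = g (f x) + r • ξ (f x) := by
    intro x
    have h1 : t * s' * s = t * t - r * (t * c) := by linear_combination -t * hc
    rw [hh, LinearMap.smul_apply, map_smul, hψ, smul_smul, h1, hξ, LinearMap.smul_apply,
      ← algebraMap_smul A (t * t - r * (t * c)), ← algebraMap_smul A r, smul_smul, map_sub, ht2,
      map_mul _ r (t * c)]
    module
  -- `h - h²` is divisible by `r` over the localization, so `s₁ (h - h²)` is divisible by `r`
  obtain ⟨s₁, hs₁, ψ₁, hψ₁⟩ := exists_smul_eq_smul (A := A) m.primeCompl f hf (r := r) (h - h ∘ₗ h)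
    (χ + ξ - g * ξ - ξ * g - r • (ξ * ξ)) (fun x => by
      have e1 := hg (f x)
      simp only [LinearMap.sub_apply, LinearMap.comp_apply, map_sub, hfh, map_add,
        LinearMap.add_apply, Module.End.mul_apply, LinearMap.smul_apply, smul_sub, smul_add, ← e1,
        LinearMap.map_smul_of_tower]
      abel)
  obtain ⟨s₁', c₁, hc₁⟩ := ht s₁ hs₁
  -- as `h` is a multiple of `t`, the element `t` acts as the identity on its values modulo `r`
  have hth : ∀ x, t • h x - h x = r • ((d * s') • ψ x) := fun x => by
    rw [hh, LinearMap.smul_apply, smul_smul, smul_smul, ← sub_smul]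
    congr 1
    linear_combination s' * hd
  refine ⟨h, s₁' • ψ₁ + c₁ • (h - h ∘ₗ h) - (d * s') • ψ + (d * s') • (h ∘ₗ ψ),
    fun x => ?_, ξ, hfh⟩
  have e1 : t • (h x - h (h x)) = r • (s₁' • ψ₁ x + c₁ • (h x - h (h x))) := by
    have e2 : t = s₁' * s₁ + r * c₁ := by linear_combination hc₁
    have e3 := hψ₁ x
    simp only [LinearMap.sub_apply, LinearMap.comp_apply] at e3
    rw [smul_add, smul_comm r s₁', ← e3, smul_smul, smul_smul, ← add_smul, ← e2]
  have e4 := congrArg h (hth x)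
  simp only [map_sub, map_smul] at e4
  have e5 : h x - h (h x) = t • (h x - h (h x)) - (t • h x - h x) + (t • h (h x) - h (h x)) := by
    rw [smul_sub]; abel
  rw [e5, e1, hth, e4]
  simp only [LinearMap.add_apply, LinearMap.sub_apply, LinearMap.smul_apply, LinearMap.comp_apply,
    smul_add, smul_sub]

end Global

/-! ### Endomorphism rings over local rings modulo their radical -/

section SemisimpleQuotient

open IsLocalRing

variable {A : Type*} [CommRing A] [IsLocalRing A] (W : Type*) [AddCommGroup W] [Module A W]
  [Module.Finite A W]

omit [IsLocalRing A] in
theorem isArtinianRing_quotient_of_ker_le {V S : Type*} [AddCommGroup V] [Module A V]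
    [IsArtinian A V] [Ring S] [Algebra A S] (I : Ideal S) [I.IsTwoSided] (Λ : S →ₗ[A] V)
    (h : ∀ s, Λ s = 0 → s ∈ I) : IsArtinianRing (S ⧸ I) := by
  have hΛ : IsArtinian A (S ⧸ LinearMap.ker Λ) :=
    isArtinian_of_injective _ (LinearMap.ker_eq_bot.1 (Submodule.ker_liftQ_eq_bot' _ Λ rfl))
  have hI : IsArtinian A (S ⧸ I.restrictScalars A) := by
    refine isArtinian_of_surjective _ (Submodule.factor (p := LinearMap.ker Λ) fun s hs => ?_)
      (Submodule.factor_surjective _)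
    exact h s hs
  have hI' : IsArtinian A (S ⧸ I) :=
    isArtinian_of_surjective _ (((I.restrictScalars A).liftQ
      ((Ideal.Quotient.mkₐ A I).toLinearMap) fun s hs => Ideal.Quotient.eq_zero_iff_mem.2 hs))
      fun y => by
        obtain ⟨s, rfl⟩ := Ideal.Quotient.mk_surjective y
        exact ⟨Submodule.Quotient.mk s, rfl⟩
  exact isArtinian_of_tower A hI'

/-- The endomorphisms of `W` that vanish modulo the maximal ideal lie in the Jacobson radical, and
those of `W` modulo the maximal ideal form a finite-dimensional algebra over the residue field. -/
theorem isSemisimpleRing_end_quotient_jacobson :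
    IsSemisimpleRing (Module.End A W ⧸ Ring.jacobson (Module.End A W)) := by
  set J := maximalIdeal A • (⊤ : Submodule A W) with hJ
  obtain ⟨n, v, hv⟩ := Module.Finite.exists_fin (R := A) (M := W)
  let Λ : Module.End A W →ₗ[A] (Fin n → W ⧸ J) :=
    LinearMap.pi fun i => J.mkQ ∘ₗ LinearMap.applyₗ (v i)
  have hΛ : ∀ s, s ∈ LinearMap.ker Λ → ∀ y, s y ∈ J := by
    intro s hs y
    have : (⊤ : Submodule A W) ≤ J.comap s := by
      rw [← hv, Submodule.span_le]
      rintro _ ⟨i, rfl⟩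
      have := congrFun (LinearMap.mem_ker.1 hs) i
      exact (Submodule.Quotient.mk_eq_zero J).1 this
    exact this Submodule.mem_top
  have hker : ∀ s ∈ LinearMap.ker Λ, s ∈ Ring.jacobson (Module.End A W) := by
    intro s hs
    rw [← Ideal.jacobson_bot, Ideal.mem_jacobson_iff]
    intro t
    have hu : IsUnit (t * s + 1) := isUnit_end_of_sub_mem_maximalIdeal_smul _ fun y => by
      have h1 : J.map t ≤ J := by
        rw [hJ, Submodule.map_smul'']
        exact Submodule.smul_mono le_rfl le_top
      simpa using h1 ⟨s y, hΛ s hs y, rfl⟩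
    obtain ⟨z, hz⟩ := hu.exists_left_inv
    refine ⟨z, ?_⟩
    rw [Ideal.mem_bot, ← hz]
    noncomm_ring
  have hV : IsArtinian A (W ⧸ J) := by
    let : Field (A ⧸ maximalIdeal A) := Ideal.Quotient.field _
    have : Module.Finite (A ⧸ maximalIdeal A) (W ⧸ J) := .of_restrictScalars_finite A _ _
    exact isArtinian_of_surjective_algebraMap (R := A ⧸ maximalIdeal A)
      Ideal.Quotient.mk_surjective
  have := isArtinianRing_quotient_of_ker_le (Ring.jacobson (Module.End A W)) Λ hker
  exact IsArtinianRing.isSemisimpleRing_iff_jacobson.mpr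
    (Ring.jacobson_quotient_jacobson _)

end SemisimpleQuotient

/-! ### The exchange property of endomorphism rings of localizations -/

section Localized

variable {R : Type u} [CommRing R]

/-- In a domain of dimension at most one, the maximal ideal of a localization at a maximal ideal is
the radical of any of its non-zero elements. -/
theorem exists_algebraMap_dvd_pow [IsDomain R] [Ring.KrullDimLE 1 R] (m : Ideal R) [m.IsMaximal]
    (A : Type*) [CommRing A] [Algebra R A] [IsLocalization.AtPrime A m] [IsLocalRing A] {r : R}
    (hr : r ≠ 0) {x : A} (hx : x ∈ IsLocalRing.maximalIdeal A) : ∃ n, algebraMap R A r ∣ x ^ n := by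
  have : x ∈ (Ideal.span {algebraMap R A r}).radical := by
    rw [Ideal.radical_eq_sInf, Ideal.mem_sInf]
    rintro P ⟨hP, hPp⟩
    have h1 : r ∈ P.comap (algebraMap R A) :=
      Ideal.mem_comap.2 (hP (Ideal.mem_span_singleton_self _))
    have h2 : P.comap (algebraMap R A) ≤ m := by
      intro y hy
      by_contra hym
      exact hPp.ne_top (P.eq_top_of_isUnit_mem hy
        (IsLocalization.map_units A (⟨y, hym⟩ : m.primeCompl)))
    have h3 : (P.comap (algebraMap R A)).IsMaximal :=
      (Ideal.IsPrime.comap _).isMaximal_of_ne_bot fun h => hr (by rwa [h] at h1)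
    have h4 := h3.eq_of_le (Ideal.IsPrime.ne_top inferInstance) h2
    rw [← IsLocalization.map_under m.primeCompl A P, Ideal.under_def, h4, 
      IsLocalization.AtPrime.map_eq_maximalIdeal m]
    exact hx
  obtain ⟨n, hn⟩ := this
  exact ⟨n, Ideal.mem_span_singleton.1 hn⟩

/-- Idempotent endomorphisms of `X × Rˡ` localize, along with their `X`-corners. -/
theorem exists_idempotent_corner_localization (S : Submonoid R) {A : Type*} [CommRing A]
    [Algebra R A] [IsLocalization S A] {X X' : Type*} [AddCommGroup X] [Module R X]
    [AddCommGroup X'] [Module R X'] [Module A X'] [IsScalarTower R A X'] (f : X →ₗ[R] X')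
    [IsLocalizedModule S f] {l : ℕ} {E : Module.End R (X × (Fin l → R))} (hE : E * E = E) :
    ∃ E' : Module.End A (X' × (Fin l → A)), E' * E' = E' ∧
      ∀ x, (E' (f x, 0)).1 = f (E (x, 0)).1 := by
  let G : (Fin l → R) →ₗ[R] (Fin l → A) :=
    LinearMap.pi fun i => Algebra.linearMap R A ∘ₗ LinearMap.proj i
  let F := f.prodMap G
  have hG : IsLocalizedModule S G := inferInstance
  have hF : IsLocalizedModule S F := inferInstance
  let E' : Module.End A (X' × (Fin l → A)) := IsLocalizedModule.mapExtendScalars S F F A E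
  have hE' : ∀ z, E' (F z) = F (E z) := fun z => by
    simp [E', IsLocalizedModule.mapExtendScalars_apply_apply, IsLocalizedModule.map_apply]
  refine ⟨E', ?_, fun x => ?_⟩
  · have : (E' * E').restrictScalars R = E'.restrictScalars R := by
      refine IsLocalizedModule.linearMap_ext S F F (LinearMap.ext fun z => ?_)
      have := LinearMap.congr_fun hE z
      rw [Module.End.mul_apply] at this
      simp [hE', this]
    exact LinearMap.ext fun z => LinearMap.congr_fun this z
  · have h1 := congrArg Prod.fst (hE' (x, 0))
    have h2 : F (x, 0) = (f x, 0) := by simp [F, map_zero]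
    rw [h2] at h1
    exact h1

end Localized

section LocalizedExchange

variable {R : Type u} [CommRing R]

/-- The endomorphism ring of `X_m` has the exchange property.

Splitting off a free summand, one may replace `X_m` by a module `Y` without free summands. For an
endomorphism `φ` of `Y`, some multiple `a φ` of it is idempotent modulo a suitable non-zero `r`; it
comes from an endomorphism `h` of `X` such that `h - h²` factors through a free module. By the
hypothesis on `X`, `h` is the corner of an idempotent of `X ⊕ R ^ l`. Localizing, and using that `Y`
has no free summands, one finds an idempotent of `Y` congruent to `a φ` modulo the maximal ideal. -/
theorem isExchangeRing_end_localization [IsDomain R] [Ring.KrullDimLE 1 R]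
    (hR : ∀ r : R, r ≠ 0 → {m : Ideal R | m.IsMaximal ∧ r ∈ m}.Finite)
    {X : Type*} [AddCommGroup X] [Module R X] [Module.Finite R X]
    (hX : SummandsAreDirectSumsOfFG R ((ℕ →₀ R) × X))
    (m : Ideal R) [m.IsMaximal] (hm : m ≠ ⊥) {A : Type*} [CommRing A] [Algebra R A]
    [IsLocalization.AtPrime A m] {X' : Type v} [AddCommGroup X'] [Module R X']
    [Module A X'] [IsScalarTower R A X'] [Module.Finite A X'] (f : X →ₗ[R] X')
    [IsLocalizedModule m.primeCompl f] (hf : Function.Injective f) :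
    IsExchangeRing (Module.End A X') := by
  have hA : IsLocalRing A := IsLocalization.AtPrime.isLocalRing A m
  obtain ⟨r₀, hr₀m, hr₀⟩ := m.ne_bot_iff.1 hm
  obtain ⟨r, hr, hdvd, b, a, hab⟩ := exists_smul_factors_through_free X hr₀
  have hrm : r ∈ m := m.mem_of_dvd hdvd hr₀m
  have hrA : algebraMap R A r ∈ IsLocalRing.maximalIdeal A :=
    (IsLocalization.AtPrime.to_map_mem_maximal_iff A m r).2 hrm
  obtain ⟨Y, _, _, n, e, hY⟩ := exists_equiv_prod_free (A := A) X'
  suffices hYex : IsExchangeRing (Module.End A Y) from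
    (hYex.prod ((IsLocalRing.isExchangeRing_end_self A).pi_fin n)).of_linearEquiv e
  have : Module.Finite A Y := .of_surjective (LinearMap.fst A Y (Fin n → A) ∘ₗ e.toLinearMap)
    (Prod.fst_surjective.comp e.surjective)
  intro φ
  obtain ⟨α, β, ψ, ψ', hψ, hψ'⟩ :=
    exists_exchange_mod (fun x hx => exists_algebraMap_dvd_pow m A hr hx) φ
  let p : X' →ₗ[A] Y := LinearMap.fst A Y (Fin n → A) ∘ₗ e.toLinearMap
  let i : Y →ₗ[A] X' := e.symm.toLinearMap ∘ₗ LinearMap.inl A Y (Fin n → A)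
  have hpi : ∀ y, p (i y) = y := fun y => by simp [p, i]
  let g : Module.End A X' := i ∘ₗ (α * φ) ∘ₗ p
  have hψy : ∀ y, α (φ y) - α (φ (α (φ y))) = algebraMap R A r • ψ y := LinearMap.congr_fun hψ
  have hg : ∀ x, g x - g (g x) = r • (i ∘ₗ ψ ∘ₗ p : Module.End A X') x := fun x => by
    simp only [g, LinearMap.comp_apply, Module.End.mul_apply, hpi]
    rw [← map_sub, hψy, map_smul, algebraMap_smul]
  obtain ⟨h, κ, hκ, ξ, hξ⟩ := exists_end_congr_localization m hr hrm (hR r hr) f hf hg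
  obtain ⟨l, E, hE, hEh⟩ := hX.exists_idempotent_corner h (b ∘ₗ κ) a fun x => by
    rw [LinearMap.comp_apply, hab, hκ]
  obtain ⟨E', hE', hE'E⟩ := exists_idempotent_corner_localization m.primeCompl (A := A) f hE
  have hE'g : ∀ x, (E' (x, 0)).1 = g x + r • ξ x := by
    have : (LinearMap.fst A X' (Fin l → A) ∘ₗ E' ∘ₗ LinearMap.inl A X' _).restrictScalars R =
        g.restrictScalars R + r • ξ.restrictScalars R := by
      refine IsLocalizedModule.linearMap_ext m.primeCompl f f (LinearMap.ext fun x => ?_)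
      have := hE'E x
      rw [hEh, hξ] at this
      exact this
    exact fun x => LinearMap.congr_fun this x
  let Ψ : ((Fin n → A) × (Fin l → A)) ≃ₗ[A] (Fin (n + l) → A) :=
    (LinearEquiv.sumArrowLequivProdArrow (Fin n) (Fin l) A A).symm ≪≫ₗ
      LinearEquiv.funCongrLeft A A finSumFinEquiv.symm
  let Θ : (X' × (Fin l → A)) ≃ₗ[A] Y × (Fin (n + l) → A) :=
    e.prodCongr (.refl A _) ≪≫ₗ .prodAssoc A _ _ _ ≪≫ₗ (LinearEquiv.refl A Y).prodCongr Ψ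
  have hΘ : ∀ z, (Θ z).1 = p z.1 := fun z => rfl
  have hΘi : ∀ y, Θ.symm (y, 0) = (i y, 0) := fun y => by
    rw [LinearEquiv.symm_apply_eq]
    refine Prod.ext ?_ ?_
    · rw [hΘ, hpi]
    · have h1 : (Θ (i y, 0)).2 = Ψ ((e (i y)).2, 0) := rfl
      have h2 : e (i y) = (y, 0) := e.apply_symm_apply _
      rw [h1, h2]
      exact (map_zero Ψ).symm
  obtain ⟨e', he', hcongr⟩ := exists_idempotent_congr_corner hY (n + l)
    (E := Θ.toLinearMap ∘ₗ E' ∘ₗ Θ.symm.toLinearMap) (LinearMap.ext fun z => by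
      have := LinearMap.congr_fun hE' (Θ.symm z)
      rw [Module.End.mul_apply] at this
      simp [this])
  have hmem : ∀ y : Y, algebraMap R A r • y ∈ IsLocalRing.maximalIdeal A • (⊤ : Submodule A Y) :=
    fun y => Submodule.smul_mem_smul hrA Submodule.mem_top
  refine exists_idempotent_of_congr (a := α) (b := β) he' (fun y => ?_) (fun y => ?_) fun y => ?_
  · have h1 := hcongr y
    simp only [LinearMap.comp_apply, LinearEquiv.coe_coe, hΘi, hΘ, hE'g, map_add] at h1
    have h2 : p (g (i y)) = α (φ y) := by simp only [g, LinearMap.comp_apply, hpi]; rfl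
    have h3 : p (r • ξ (i y)) = algebraMap R A r • p (ξ (i y)) := by
      rw [← algebraMap_smul A, map_smul]
    rw [h2, h3] at h1
    have h4 := Submodule.add_mem _ h1 (hmem (p (ξ (i y))))
    rwa [sub_add_eq_sub_sub, sub_add_cancel] at h4
  · rw [hψy]
    exact hmem _
  · have h1 : α (φ y) + β (y - φ y) - y = algebraMap R A r • ψ' y := LinearMap.congr_fun hψ' y
    rw [h1]
    exact hmem _

end LocalizedExchange

/-! ### Direct summands over the localization -/

/-- `A^(ω) ⊕ W` is a direct summand of `(A ⊕ W)^(ω)`. The index set is lifted to the universe of the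
submodules of `A^(ω) ⊕ W`, as `MemAdd` requires. -/
theorem SummandsAreDirectSumsOfFG.of_memAdd {A : Type u} [Ring A] {W : Type v} [AddCommGroup W]
    [Module A W]
    (h : ∀ (N : Type (max u v)) [AddCommGroup N] [Module A N], MemAdd A (A × W) N →
      IsDirectSumOfFG A N) : SummandsAreDirectSumsOfFG A ((ℕ →₀ A) × W) := by
  intro N N' hN
  let s : (ℕ →₀ A) × W →ₗ[A] (ULift.{max u v} ℕ →₀ A × W) :=
    (Finsupp.domLCongr Equiv.ulift.symm).toLinearMap ∘ₗ
      (Finsupp.mapRange.linearMap (LinearMap.inl A A W)).coprod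
        (Finsupp.lsingle 0 ∘ₗ LinearMap.inr A A W)
  let q : (ULift.{max u v} ℕ →₀ A × W) →ₗ[A] (ℕ →₀ A) × W :=
    ((Finsupp.mapRange.linearMap (LinearMap.fst A A W)).prod
      (LinearMap.snd A A W ∘ₗ Finsupp.lapply 0)) ∘ₗ
        (Finsupp.domLCongr Equiv.ulift).toLinearMap
  have hqs : ∀ z, q (s z) = z := by
    rintro ⟨f, x⟩
    refine Prod.ext (Finsupp.ext fun n => ?_) ?_
    · by_cases hn : n = 0 <;> simp [q, s, hn]
    · simp [q, s]
  refine h N ⟨ULift.{max u v} ℕ, s ∘ₗ N.subtype, N.projectionOnto N' hN ∘ₗ q,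
    LinearMap.ext fun z => ?_⟩
  simp [hqs]

theorem mainTheorem10 (R : Type u) [CommRing R] [IsDomain R]
    (hR : IsHLocalDomain R) (hdim : ringKrullDim R = 1)
    (X : Type v) [AddCommGroup X] [Module R X] [Module.Finite R X] [Module.IsTorsionFree R X]
    (hX : SummandsAreDirectSumsOfFG R ((ℕ →₀ R) × X))
    (m : Ideal R) [m.IsMaximal] :
    -- the endomorphism ring of the localization at `m` is semiperfect
    IsSemiperfectRing (Module.End (Localization.AtPrime m) (LocalizedModule.AtPrime m X)) ∧
    -- every module in `Add(R_m ⊕ X_m)` is a direct sum of finitely generated modules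
    (∀ (N : Type w) [AddCommGroup N] [Module (Localization.AtPrime m) N],
      MemAdd (Localization.AtPrime m) (Localization.AtPrime m × LocalizedModule.AtPrime m X) N →
        IsDirectSumOfFG (Localization.AtPrime m) N) ∧
    -- every direct summand of `R_m^(ω) ⊕ X_m` is a direct sum of finitely generated modules
    SummandsAreDirectSumsOfFG (Localization.AtPrime m)
      ((ℕ →₀ Localization.AtPrime m) × LocalizedModule.AtPrime m X) ∧
    -- every f.g. indecomposable module in `Add(R_m ⊕ X_m)` has local endomorphism ring
    (∀ (N : Type w) [AddCommGroup N] [Module (Localization.AtPrime m) N],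
      MemAdd (Localization.AtPrime m) (Localization.AtPrime m × LocalizedModule.AtPrime m X) N →
        Module.Finite (Localization.AtPrime m) N →
          IsIndecomposableModule (Localization.AtPrime m) N →
            IsLocalRing (Module.End (Localization.AtPrime m) N)) := by
  have hKD : Ring.KrullDimLE 1 R := Ring.krullDimLE_iff.2 hdim.le
  have hm : m ≠ ⊥ := by
    rintro rfl
    have hf : IsField R := Ring.isField_iff_maximal_bot.2 inferInstance
    rw [ringKrullDim_eq_zero_of_isField hf] at hdim
    exact zero_ne_one hdim
  set A := Localization.AtPrime m
  set X' := LocalizedModule.AtPrime m X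
  let f : X →ₗ[R] X' := LocalizedModule.mkLinearMap m.primeCompl X
  have hf : Function.Injective f := by
    rw [injective_iff_map_eq_zero]
    intro x hx
    obtain ⟨c, hc⟩ := (IsLocalizedModule.eq_zero_iff m.primeCompl f).1 hx
    refine (smul_eq_zero.1 hc).resolve_left fun h => c.2 ?_
    rw [h]
    exact m.zero_mem
  have hfin : Module.Finite A X' := Module.Finite.of_isLocalizedModule m.primeCompl f
  have hex : IsExchangeRing (Module.End A X') :=
    isExchangeRing_end_localization hR.finite_character hX m hm f hf
  have hZ : IsExchangeRing (Module.End A (A × X')) :=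
    (IsLocalRing.isExchangeRing_end_self A).prod hex
  exact ⟨⟨isSemisimpleRing_end_quotient_jacobson X', fun e he => hex.exists_lift _ e he⟩,
    fun N _ _ hN => hN.isDirectSumOfFG hZ,
    .of_memAdd fun N _ _ hN => hN.isDirectSumOfFG hZ,
    fun N _ _ hN _ hind => hind.isLocalRing_end (hN.isExchangeRing_end hZ)⟩
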